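/- An infinite Young tableau is a matrix $t=(t_{i,j})_{i,j\ge 1}$ of positive integers in which every positive integer appears exactly once and whose rows and columns are increasing. Let $\Omega$ be the set of infinite Young tableaux and $\mathcal F$ the smallest $\sigma$-algebra on $\Omega$ making all maps $t\mapsto t_{i,j}$ measurable. For a Young diagram $\lambda$ let $|\lambda|$ be its number of boxes and $f^\lambda$ the number of standard Young tableaux of shape $\lambda$, and write $\lambda\nearrow\nu$ if $\nu$ arises from $\lambda$ by adding one box. The Plancherel growth process is the Markov chain $\emptyset=\Lambda_0\nearrow\Lambda_1\nearrow\cdots$ on Young diagrams with transition probability $\frac{f^\nu}{(|\lambda|+1)f^\lambda}$ from $\lambda$ to each $\nu$ with $\lambda\nearrow\nu$. A tableau $t\in\Omega$ is identified with the path $\Lambda_n(t)=\{(i,j): t_{i,j}\le n\}$; this identifies $\Omega$ with the set of paths in the Young graph that start at $\emptyset$ and eventually contain every box. The Plancherel measure $\mathsf P$ on $(\Omega,\mathcal F)$ is the law of the Plancherel growth process under this identification. The jeu de taquin path of $t\in\Omega$ is $\mathbf p_1=(1,1)$ and, if $\mathbf p_k=(i,j)$, $\mathbf p_{k+1}$ is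 the one of the boxes $(i+1,j)$, $(i,j+1)$ with the smaller entry in $t$. The jeu de taquin map $J:\Omega\to\Omega$ is defined by $J(t)_{\mathbf p_k}=t_{\mathbf p_{k+1}}-1$ for all $k$, and $J(t)_{i,j}=t_{i,j}-1$ if $(i,j)$ is not on the path. For a sequence $x=(x_1,x_2,\dots)$ of distinct numbers in $[0,1]$ let $\lambda_n$ be the shape obtained by Robinson--Schensted row insertion of $x_1,\dots,x_n$. If every box eventually belongs to some $\lambda_n$, then $\mathrm{RSK}(x)\in\Omega$ is defined as the recording tableau of $\emptyset=\lambda_0\nearrow\lambda_1\nearrow\cdots$, i.e. $\Lambda_n(\mathrm{RSK}(x))=\lambda_n$ for all $n$. Let $S(x_1,x_2,\dots)=(x_2,x_3,\dots)$ be the shift on $[0,1]^{\mathbb N}$ with the product $\mathrm{Leb}^{\otimes\mathbb N}$ of Lebesgue measures. **Theorem (Measure preservation and ergodicity).** $\mathsf P$ is a probability measure, and the dynamical system $(\Omega,\mathcal F,\mathsf P,J)$ is measure-preserving and ergodic. Moreover it is a factor, via $\mathrm{RSK}$, of the i.i.d. shift $([0,1]^{\mathbb N},\mathrm{Leb}^{\otimes\mathbb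 N},S)$: $\mathrm{RSK}(x)$ is defined for $\mathrm{Leb}^{\otimes\mathbb N}$-almost every $x$, the map $\mathrm{RSK}$ is measurable and pushes $\mathrm{Leb}^{\otimes\mathbb N}$ forward to $\mathsf P$, and whenever $\mathrm{RSK}(x)$ is defined, so is $\mathrm{RSK}(Sx)$, and $J(\mathrm{RSK}(x))=\mathrm{RSK}(Sx)$. -/

import Mathlib

open MeasureTheory ProbabilityTheory
open scoped ENNReal

namespace JeuDeTaquin

/-- The edge relation `μ ↗ ν` of the Young graph: `ν` is `μ` with one box added. -/
def Adds (μ ν : YoungDiagram) : Prop := μ ≤ ν ∧ ν.card = μ.card + 1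

/-- `T` is a standard Young tableau of shape `μ`: the boxes of `μ` are filled bijectively with
`1, …, |μ|`, increasingly along rows and columns (and `T` is `0` off `μ`, so that `T` is
determined by the filling). -/
structure IsStandardTableau (μ : YoungDiagram) (T : ℕ × ℕ → ℕ) : Prop where
  zero_off : ∀ c, c ∉ μ → T c = 0
  bijOn : Set.BijOn T (μ : Set (ℕ × ℕ)) (Set.Icc 1 μ.card)
  row_lt : ∀ i j, (i, j + 1) ∈ μ → T (i, j) < T (i, j + 1)
  col_lt : ∀ i j, (i + 1, j) ∈ μ → T (i, j) < T (i + 1, j)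

/-- `f^μ`, the number of standard Young tableaux of shape `μ`. -/
noncomputable def numSYT (μ : YoungDiagram) : ℕ := Nat.card {T : ℕ × ℕ → ℕ // IsStandardTableau μ T}

theorem finite_standardTableau (μ : YoungDiagram) :
    Finite {T : ℕ × ℕ → ℕ // IsStandardTableau μ T} := by
  refine Finite.of_injective
    (β := μ.cells → Fin (μ.card + 1))
    (fun T c => ⟨T.1 c.1, Nat.lt_succ_of_le (T.2.bijOn.mapsTo c.2).2⟩) ?_
  intro S T h
  apply Subtype.ext
  funext c
  by_cases hc : c ∈ μ
  · have := congrFun h ⟨c, hc⟩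
    simpa using this
  · rw [S.2.zero_off c hc, T.2.zero_off c hc]

theorem numSYT_bot : numSYT ⊥ = 1 := by
  rw [numSYT, Nat.card_eq_one_iff_unique]
  refine ⟨⟨fun S T => Subtype.ext (funext fun c => ?_)⟩, ⟨⟨fun _ => 0, ?_⟩⟩⟩
  · rw [S.2.zero_off c (YoungDiagram.notMem_bot c), T.2.zero_off c (YoungDiagram.notMem_bot c)]
  · constructor <;> simp [YoungDiagram.card, Set.BijOn, Set.MapsTo, Set.SurjOn, Set.InjOn]

/-- Removing the box with the largest entry. -/
def delMax (ν : YoungDiagram) (T : ℕ × ℕ → ℕ) (hT : IsStandardTableau ν T) : YoungDiagram where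
  cells := ν.cells.filter (fun c => T c ≠ ν.card)
  isLowerSet := by
    rintro ⟨i, j⟩ ⟨i', j'⟩ hle hc
    obtain ⟨hi, hj⟩ := Prod.mk_le_mk.1 hle
    simp only [Finset.coe_filter, Set.mem_ofPred_eq, YoungDiagram.mem_cells] at hc ⊢
    refine ⟨ν.up_left_mem hi hj hc.1, fun hmax => ?_⟩
    have key : ∀ d, d ∈ ν → T d ≤ ν.card := fun d hd => (hT.bijOn.mapsTo hd).2
    rcases Nat.lt_or_ge i' i with h | h
    · have hm : (i' + 1, j') ∈ ν := ν.up_left_mem h hj hc.1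
      have := hT.col_lt _ _ hm
      have := key _ hm
      omega
    · rcases Nat.lt_or_ge j' j with h' | h'
      · have hm : (i', j' + 1) ∈ ν := ν.up_left_mem hi h' hc.1
        have := hT.row_lt _ _ hm
        have := key _ hm
        omega
      · obtain rfl : i' = i := le_antisymm hi h
        obtain rfl : j' = j := le_antisymm hj h'
        exact hc.2 hmax

theorem mem_delMax {ν : YoungDiagram} {T : ℕ × ℕ → ℕ} (hT : IsStandardTableau ν T) {c : ℕ × ℕ} :
    c ∈ delMax ν T hT ↔ c ∈ ν ∧ T c ≠ ν.card := by
  rw [← YoungDiagram.mem_cells]; simp [delMax]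

theorem adds_delMax {ν : YoungDiagram} {T : ℕ × ℕ → ℕ} (hT : IsStandardTableau ν T)
    (hν : 0 < ν.card) : Adds (delMax ν T hT) ν := by
  refine ⟨fun c hc => ((mem_delMax hT).1 hc).1, ?_⟩
  obtain ⟨m, hm, hTm⟩ := hT.bijOn.surjOn (Set.mem_Icc.2 ⟨hν, le_rfl⟩)
  have : (delMax ν T hT).cells = ν.cells.erase m := by
    ext c
    simp only [YoungDiagram.mem_cells, mem_delMax, Finset.mem_erase]
    constructor
    · rintro ⟨h1, h2⟩
      exact ⟨fun h => h2 (h ▸ hTm), h1⟩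
    · rintro ⟨h1, h2⟩
      exact ⟨h2, fun h => h1 (hT.bijOn.injOn h2 hm (h.trans hTm.symm))⟩
  have hm' : m ∈ ν.cells := hm
  rw [YoungDiagram.card, YoungDiagram.card, this, Finset.card_erase_add_one hm']

theorem isStandardTableau_delMax {ν : YoungDiagram} {T : ℕ × ℕ → ℕ} (hT : IsStandardTableau ν T)
    (hν : 0 < ν.card) :
    IsStandardTableau (delMax ν T hT) (fun c => if T c = ν.card then 0 else T c) := by
  have hcard := (adds_delMax hT hν).2
  refine ⟨fun c hc => ?_, ⟨fun c hc => ?_, fun c hc d hd h => ?_, fun k hk => ?_⟩,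
    fun i j h => ?_, fun i j h => ?_⟩
  · rw [mem_delMax] at hc
    by_cases h : T c = ν.card
    · simp [h]
    · have : c ∉ ν := fun h' => hc ⟨h', h⟩
      simp [hT.zero_off c this]
  · obtain ⟨h1, h2⟩ := (mem_delMax hT).1 hc
    have := hT.bijOn.mapsTo h1
    simp only [h2, if_false, Set.mem_Icc] at this ⊢
    omega
  · obtain ⟨h1, h2⟩ := (mem_delMax hT).1 hc
    obtain ⟨h3, h4⟩ := (mem_delMax hT).1 hd
    simp only [h2, h4, if_false] at h
    exact hT.bijOn.injOn h1 h3 h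
  · obtain ⟨c, hc, hk'⟩ := hT.bijOn.surjOn (a := k) (Set.mem_Icc.2 ⟨hk.1, by have := hk.2; omega⟩)
    have hne : T c ≠ ν.card := by have := hk.2; omega
    exact ⟨c, (mem_delMax hT).2 ⟨hc, hne⟩, (if_neg hne).trans hk'⟩
  · have hm := (mem_delMax hT).1 h
    have h1 := hT.row_lt i j hm.1
    have h2 := (hT.bijOn.mapsTo hm.1).2
    have h3 : T (i, j) ≠ ν.card := by omega
    simpa [hm.2, h3] using h1
  · have hm := (mem_delMax hT).1 h
    have h1 := hT.col_lt i j hm.1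
    have h2 := (hT.bijOn.mapsTo hm.1).2
    have h3 : T (i, j) ≠ ν.card := by omega
    simpa [hm.2, h3] using h1

theorem isStandardTableau_extend {μ ν : YoungDiagram} (h : Adds μ ν) {T : ℕ × ℕ → ℕ}
    (hT : IsStandardTableau μ T) :
    IsStandardTableau ν (fun c => if c ∈ ν ∧ c ∉ μ then ν.card else T c) := by
  have hcard := h.2
  have hsub : μ.cells ⊆ ν.cells := h.1
  have hone : (ν.cells \ μ.cells).card = 1 := by
    rw [Finset.card_sdiff_of_subset hsub]
    have h1 : ν.cells.card = μ.cells.card + 1 := hcard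
    omega
  obtain ⟨m, hm⟩ := Finset.card_eq_one.1 hone
  have hmem : ∀ c, (c ∈ ν ∧ c ∉ μ) ↔ c = m := fun c => by
    have := Finset.ext_iff.1 hm c
    simpa using this
  have hmm := (hmem m).2 rfl
  have hin : ∀ c, c ∈ ν → c ≠ m → c ∈ μ := fun c hc hne => by
    by_contra hcon
    exact hne ((hmem c).1 ⟨hc, hcon⟩)
  have hμm : ∀ c, c ∈ μ → c ≠ m := fun c hc he => hmm.2 (he ▸ hc)
  simp only [hmem]
  refine ⟨fun c hc => ?_, ⟨fun c hc => ?_, fun c hc d hd he => ?_, fun k hk => ?_⟩,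
    fun i j h' => ?_, fun i j h' => ?_⟩
  · have h1 : c ≠ m := fun he => hc (he ▸ hmm.1)
    simp [h1, hT.zero_off c (fun h2 => hc (hsub h2))]
  · by_cases h1 : c = m
    · simp only [h1, if_true, Set.mem_Icc]; omega
    · have := hT.bijOn.mapsTo (hin c hc h1)
      simp only [h1, if_false, Set.mem_Icc] at this ⊢
      omega
  · by_cases h1 : c = m <;> by_cases h2 : d = m
    · rw [h1, h2]
    · have := (hT.bijOn.mapsTo (hin d hd h2)).2
      simp only [h1, h2, if_true, if_false] at he
      omega
    · have := (hT.bijOn.mapsTo (hin c hc h1)).2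
      simp only [h1, h2, if_true, if_false] at he
      omega
    · simp only [h1, h2, if_false] at he
      exact hT.bijOn.injOn (hin c hc h1) (hin d hd h2) he
  · by_cases h1 : k = ν.card
    · exact ⟨m, hmm.1, by simp [h1]⟩
    · obtain ⟨c, hc, hck⟩ := hT.bijOn.surjOn (a := k)
        (Set.mem_Icc.2 ⟨hk.1, by have := hk.2; omega⟩)
      exact ⟨c, hsub hc, by simp [hμm c hc, hck]⟩
  · have hl : (i, j) ∈ ν := ν.up_left_mem le_rfl (Nat.le_succ j) h'
    by_cases h1 : (i, j + 1) = m
    · have h2 : (i, j) ≠ m := by rw [← h1]; simp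
      have := (hT.bijOn.mapsTo (hin _ hl h2)).2
      simp only [h1, h2, if_true, if_false]
      omega
    · have h3 := hin _ h' h1
      have h2 := hμm _ (μ.up_left_mem le_rfl (Nat.le_succ j) h3)
      simpa [h1, h2] using hT.row_lt i j h3
  · have hl : (i, j) ∈ ν := ν.up_left_mem (Nat.le_succ i) le_rfl h'
    by_cases h1 : (i + 1, j) = m
    · have h2 : (i, j) ≠ m := by rw [← h1]; simp
      have := (hT.bijOn.mapsTo (hin _ hl h2)).2
      simp only [h1, h2, if_true, if_false]
      omega
    · have h3 := hin _ h' h1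
      have h2 := hμm _ (μ.up_left_mem (Nat.le_succ i) le_rfl h3)
      simpa [h1, h2] using hT.col_lt i j h3

theorem eq_delMax_extend {μ ν : YoungDiagram} (h : Adds μ ν) {T : ℕ × ℕ → ℕ}
    (hT : IsStandardTableau μ T) :
    delMax ν _ (isStandardTableau_extend h hT) = μ := by
  ext c
  simp only [YoungDiagram.mem_cells, mem_delMax]
  have hcard := h.2
  constructor
  · rintro ⟨h1, h2⟩
    by_contra h3
    simp [h1, h3] at h2
  · intro hc
    refine ⟨h.1 hc, ?_⟩
    have := (hT.bijOn.mapsTo hc).2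
    simp only [hc, not_true_eq_false, and_false, if_false]
    omega

/-- There are finitely many Young diagrams with `n` boxes. -/
theorem finite_card_eq (n : ℕ) : {μ : YoungDiagram | μ.card = n}.Finite := by
  refine Set.Finite.of_finite_image (f := YoungDiagram.cells)
    (((Finset.range n ×ˢ Finset.range n).powerset).finite_toSet.subset ?_)
    (fun μ _ ν _ h => YoungDiagram.ext h)
  rintro _ ⟨μ, hμ, rfl⟩
  simp only [Finset.coe_powerset, Set.mem_preimage, Set.mem_powerset_iff, Finset.coe_subset]
  rintro ⟨i, j⟩ hc
  have hc' : (i, j) ∈ μ := hc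
  have h1 : (Finset.range (i + 1) ×ˢ {0}) ⊆ μ.cells := by
    rintro ⟨a, b⟩ hab
    simp only [Finset.mem_product, Finset.mem_range, Finset.mem_singleton] at hab
    exact μ.up_left_mem (by omega) (by omega) hc'
  have h2 : ({0} ×ˢ Finset.range (j + 1)) ⊆ μ.cells := by
    rintro ⟨a, b⟩ hab
    simp only [Finset.mem_product, Finset.mem_range, Finset.mem_singleton] at hab
    exact μ.up_left_mem (by omega) (by omega) hc'
  have h1' := Finset.card_le_card h1
  have h2' := Finset.card_le_card h2
  have hμ' : μ.cells.card = n := hμ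
  simp only [Finset.card_product, Finset.card_range, Finset.card_singleton, mul_one, one_mul]
    at h1' h2'
  simp only [Finset.mem_product, Finset.mem_range]
  omega

/-- The finite set of Young diagrams with `n` boxes. -/
noncomputable def diagrams (n : ℕ) : Finset YoungDiagram := (finite_card_eq n).toFinset

theorem mem_diagrams {n : ℕ} {μ : YoungDiagram} : μ ∈ diagrams n ↔ μ.card = n := by
  simp [diagrams]

open Classical in
/-- The branching rule `f^ν = ∑_{μ ↗ ν} f^μ`. -/
theorem numSYT_branching (n : ℕ) {ν : YoungDiagram} (hν : ν.card = n + 1) :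
    numSYT ν = ∑ μ ∈ (diagrams n).filter (· ≤ ν), numSYT μ := by
  have hν0 : 0 < ν.card := by omega
  have hmem : ∀ μ, μ ∈ (diagrams n).filter (· ≤ ν) ↔ Adds μ ν := fun μ => by
    rw [Finset.mem_filter, mem_diagrams, Adds, hν]
    constructor
    · rintro ⟨h1, h2⟩; exact ⟨h2, by omega⟩
    · rintro ⟨h1, h2⟩; exact ⟨by omega, h1⟩
  rw [← Finset.sum_coe_sort]
  have := finite_standardTableau
  unfold numSYT
  rw [← Nat.card_sigma]
  refine Nat.card_congr
    { toFun := fun T => ⟨⟨delMax ν T.1 T.2, (hmem _).2 (adds_delMax T.2 hν0)⟩,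
        ⟨_, isStandardTableau_delMax T.2 hν0⟩⟩
      invFun := fun p => ⟨_, isStandardTableau_extend ((hmem _).1 p.1.2) p.2.2⟩
      left_inv := ?_
      right_inv := ?_ }
  · rintro ⟨T, hT⟩
    apply Subtype.ext
    funext c
    simp only [mem_delMax]
    by_cases h1 : T c = ν.card
    · have : c ∈ ν := by
        by_contra h2
        rw [hT.zero_off c h2] at h1
        omega
      simp [h1, this]
    · simp [h1]
  · rintro ⟨⟨μ, hμ⟩, ⟨T, hT⟩⟩
    have hadd := (hmem _).1 hμ
    have hcard := hadd.2
    have e := eq_delMax_extend hadd hT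
    refine Sigma.subtype_ext (Subtype.ext e) ?_
    funext c
    simp only
    by_cases h1 : c ∈ ν ∧ c ∉ μ
    · simp only [h1, not_false_eq_true, and_self, if_true]
      exact (hT.zero_off c h1.2).symm
    · simp only [h1, if_false]
      by_cases h2 : c ∈ μ
      · have := (hT.bijOn.mapsTo h2).2
        have hc2 : ν.card = μ.card + 1 := hcard
        have hc3 : T c ≤ μ.card := this
        rw [if_neg (by omega)]
      · simp [hT.zero_off c h2]


theorem exists_eq_insert {μ ν : YoungDiagram} (h : Adds μ ν) :
    ∃ m, m ∉ μ ∧ ∀ c, c ∈ ν ↔ c = m ∨ c ∈ μ := by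
  have hsub : μ.cells ⊆ ν.cells := h.1
  have hone : (ν.cells \ μ.cells).card = 1 := by
    rw [Finset.card_sdiff_of_subset hsub]
    have h1 : ν.cells.card = μ.cells.card + 1 := h.2
    omega
  obtain ⟨m, hm⟩ := Finset.card_eq_one.1 hone
  have hmem : ∀ c, (c ∈ ν ∧ c ∉ μ) ↔ c = m := fun c => by
    have := Finset.ext_iff.1 hm c
    simpa using this
  refine ⟨m, ((hmem m).2 rfl).2, fun c => ⟨fun hc => ?_, ?_⟩⟩
  · by_cases h1 : c ∈ μ
    · exact Or.inr h1
    · exact Or.inl ((hmem c).1 ⟨hc, h1⟩)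
  · rintro (rfl | hc)
    · exact ((hmem _).2 rfl).1
    · exact h.1 hc

/-- The rows of `μ` from which a box can be removed. -/
def cornerRows (μ : YoungDiagram) : Finset ℕ :=
  (μ.cells.image Prod.fst).filter (fun i => μ.rowLen (i + 1) < μ.rowLen i)

theorem mem_cornerRows {μ : YoungDiagram} {i : ℕ} :
    i ∈ cornerRows μ ↔ μ.rowLen (i + 1) < μ.rowLen i := by
  simp only [cornerRows, Finset.mem_filter, Finset.mem_image, and_iff_right_iff_imp]
  intro h
  exact ⟨(i, 0), YoungDiagram.mem_iff_lt_rowLen.2 (by omega), rfl⟩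

/-- Adding a box at the end of row `i`. -/
def addBox (μ : YoungDiagram) (i : ℕ) (hi : i = 0 ∨ ∃ k ∈ cornerRows μ, k + 1 = i) :
    YoungDiagram where
  cells := insert (i, μ.rowLen i) μ.cells
  isLowerSet := by
    rintro ⟨a, b⟩ ⟨a', b'⟩ hle hc
    obtain ⟨ha, hb⟩ := Prod.mk_le_mk.1 hle
    simp only [Finset.coe_insert, Set.mem_insert_iff, Finset.mem_coe, YoungDiagram.mem_cells,
      Prod.mk.injEq] at hc ⊢
    rcases hc with ⟨rfl, rfl⟩ | hc
    · by_cases hb' : b' = μ.rowLen a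
      · by_cases ha' : a' = a
        · exact Or.inl ⟨ha', hb'⟩
        · right
          rcases hi with h0 | ⟨k, hk, rfl⟩
          · omega
          · rw [mem_cornerRows] at hk
            have := μ.rowLen_anti a' k (by omega)
            exact YoungDiagram.mem_iff_lt_rowLen.2 (by omega)
      · right
        have := μ.rowLen_anti a' a ha
        exact YoungDiagram.mem_iff_lt_rowLen.2 (by omega)
    · exact Or.inr (μ.up_left_mem ha hb hc)

theorem mem_addBox {μ : YoungDiagram} {i : ℕ} (hi : i = 0 ∨ ∃ k ∈ cornerRows μ, k + 1 = i)
    {c : ℕ × ℕ} : c ∈ addBox μ i hi ↔ c = (i, μ.rowLen i) ∨ c ∈ μ := by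
  rw [← YoungDiagram.mem_cells]; simp [addBox]

theorem end_notMem (μ : YoungDiagram) (i : ℕ) : (i, μ.rowLen i) ∉ μ := by
  rw [YoungDiagram.mem_iff_lt_rowLen]; omega

/-- Removing the box at the end of row `i`. -/
def delBox (μ : YoungDiagram) (i : ℕ) (hi : i ∈ cornerRows μ) : YoungDiagram where
  cells := μ.cells.erase (i, μ.rowLen i - 1)
  isLowerSet := by
    rw [mem_cornerRows] at hi
    rintro ⟨a, b⟩ ⟨a', b'⟩ hle hc
    obtain ⟨ha, hb⟩ := Prod.mk_le_mk.1 hle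
    simp only [Finset.coe_erase, Set.mem_sdiff, Set.mem_singleton_iff, Finset.mem_coe,
      YoungDiagram.mem_cells, Prod.mk.injEq] at hc ⊢
    refine ⟨μ.up_left_mem ha hb hc.1, ?_⟩
    rintro ⟨rfl, rfl⟩
    have h1 := YoungDiagram.mem_iff_lt_rowLen.1 hc.1
    by_cases h2 : a = a'
    · subst h2
      apply hc.2
      omega
    · have := μ.rowLen_anti (a' + 1) a (by omega)
      omega

theorem mem_delBox {μ : YoungDiagram} {i : ℕ} (hi : i ∈ cornerRows μ) {c : ℕ × ℕ} :
    c ∈ delBox μ i hi ↔ c ≠ (i, μ.rowLen i - 1) ∧ c ∈ μ := by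
  rw [← YoungDiagram.mem_cells]; simp [delBox]

theorem adds_addBox {μ : YoungDiagram} {i : ℕ} (hi : i = 0 ∨ ∃ k ∈ cornerRows μ, k + 1 = i) :
    Adds μ (addBox μ i hi) := by
  refine ⟨fun c hc => (mem_addBox hi).2 (Or.inr hc), ?_⟩
  rw [YoungDiagram.card, YoungDiagram.card, addBox, Finset.card_insert_of_notMem]
  exact end_notMem μ i

theorem adds_delBox {μ : YoungDiagram} {i : ℕ} (hi : i ∈ cornerRows μ) :
    Adds (delBox μ i hi) μ := by
  refine ⟨fun c hc => ((mem_delBox hi).1 hc).2, ?_⟩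
  have : (i, μ.rowLen i - 1) ∈ μ.cells := by
    rw [mem_cornerRows] at hi
    rw [YoungDiagram.mem_cells, YoungDiagram.mem_iff_lt_rowLen]
    omega
  rw [YoungDiagram.card, YoungDiagram.card, delBox, Finset.card_erase_add_one this]

open Classical in
theorem card_up {n : ℕ} {μ : YoungDiagram} (hμ : μ.card = n) :
    ((diagrams (n + 1)).filter (μ ≤ ·)).card = (cornerRows μ).card + 1 := by
  have hset : ((cornerRows μ).card + 1) = (insert 0 ((cornerRows μ).image (· + 1))).card := by
    rw [Finset.card_insert_of_notMem (by simp),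
      Finset.card_image_of_injective _ (add_left_injective 1)]
  have hS : ∀ i, i ∈ insert 0 ((cornerRows μ).image (· + 1)) →
      (i = 0 ∨ ∃ k ∈ cornerRows μ, k + 1 = i) := fun i hi => by simpa using hi
  rw [hset]
  symm
  refine Finset.card_bij (fun i hi => addBox μ i (hS i hi)) (fun i hi => ?_)
    (fun i hi k hk h => ?_) (fun ν hν => ?_)
  · have := adds_addBox (hS i hi)
    rw [Finset.mem_filter, mem_diagrams]
    exact ⟨by rw [this.2, hμ], this.1⟩
  · have h1 : (i, μ.rowLen i) ∈ addBox μ k (hS k hk) := by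
      rw [← h, mem_addBox]; exact Or.inl rfl
    rw [mem_addBox] at h1
    rcases h1 with h1 | h1
    · exact (Prod.mk.inj h1).1
    · exact absurd h1 (end_notMem μ i)
  · rw [Finset.mem_filter, mem_diagrams] at hν
    obtain ⟨⟨i, j⟩, hm, hc⟩ := exists_eq_insert (μ := μ) (ν := ν) ⟨hν.2, by omega⟩
    have hij : (i, j) ∈ ν := (hc _).2 (Or.inl rfl)
    have hj : j = μ.rowLen i := by
      rw [YoungDiagram.mem_iff_lt_rowLen] at hm
      by_contra hne
      have h1 : (i, μ.rowLen i) ∈ ν := ν.up_left_mem le_rfl (by omega) hij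
      rcases (hc _).1 h1 with h2 | h2
      · exact hne (Prod.mk.inj h2).2.symm
      · exact end_notMem μ i h2
    have hi : i ∈ insert 0 ((cornerRows μ).image (· + 1)) := by
      rcases i with _ | k
      · simp
      · rw [Finset.mem_insert, Finset.mem_image]
        refine Or.inr ⟨k, ?_, rfl⟩
        have h1 : (k, j) ∈ ν := ν.up_left_mem (Nat.le_succ k) le_rfl hij
        rcases (hc _).1 h1 with h2 | h2
        · have := (Prod.mk.inj h2).1
          omega
        · rw [YoungDiagram.mem_iff_lt_rowLen] at h2
          rw [mem_cornerRows]
          omega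
    refine ⟨i, hi, ?_⟩
    ext c
    rw [YoungDiagram.mem_cells, YoungDiagram.mem_cells, mem_addBox, hc, hj]

open Classical in
theorem card_down {n : ℕ} {μ : YoungDiagram} (hμ : μ.card = n + 1) :
    ((diagrams n).filter (· ≤ μ)).card = (cornerRows μ).card := by
  symm
  refine Finset.card_bij (fun i hi => delBox μ i hi) (fun i hi => ?_)
    (fun i hi k hk h => ?_) (fun κ hκ => ?_)
  · have := adds_delBox hi
    have h2 := this.2
    rw [Finset.mem_filter, mem_diagrams]
    exact ⟨by omega, this.1⟩
  · have h0 : (i, μ.rowLen i - 1) ∈ μ := by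
      rw [mem_cornerRows] at hi
      rw [YoungDiagram.mem_iff_lt_rowLen]
      omega
    have h1 : (i, μ.rowLen i - 1) ∉ delBox μ k hk := by
      rw [← h, mem_delBox]; simp
    rw [mem_delBox] at h1
    by_contra hne
    exact h1 ⟨fun h2 => hne (Prod.mk.inj h2).1, h0⟩
  · rw [Finset.mem_filter, mem_diagrams] at hκ
    obtain ⟨⟨i, j⟩, hm, hc⟩ := exists_eq_insert (μ := κ) (ν := μ) ⟨hκ.2, by omega⟩
    have hij : (i, j) ∈ μ := (hc _).2 (Or.inl rfl)
    have hlt := YoungDiagram.mem_iff_lt_rowLen.1 hij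
    have hj : j = μ.rowLen i - 1 := by
      by_contra hne
      have h1 : (i, j + 1) ∈ μ := by
        rw [YoungDiagram.mem_iff_lt_rowLen]
        omega
      rcases (hc _).1 h1 with h2 | h2
      · have := (Prod.mk.inj h2).2
        omega
      · exact hm (κ.up_left_mem le_rfl (Nat.le_succ j) h2)
    have hi : i ∈ cornerRows μ := by
      rw [mem_cornerRows]
      by_contra hne
      have h1 : (i + 1, j) ∈ μ := by
        rw [YoungDiagram.mem_iff_lt_rowLen]
        omega
      rcases (hc _).1 h1 with h2 | h2
      · have := (Prod.mk.inj h2).1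
        omega
      · exact hm (κ.up_left_mem (Nat.le_succ i) le_rfl h2)
    refine ⟨i, hi, ?_⟩
    ext c
    rw [YoungDiagram.mem_cells, YoungDiagram.mem_cells, mem_delBox, ← hj, hc]
    constructor
    · rintro ⟨h1, h2 | h2⟩
      · exact absurd h2 h1
      · exact h2
    · intro h1
      exact ⟨fun h2 => hm (h2 ▸ h1), Or.inr h1⟩

theorem eq_bot_of_card {μ : YoungDiagram} (h : μ.card = 0) : μ = ⊥ := by
  ext c
  have : μ.cells = ∅ := Finset.card_eq_zero.1 h
  simp [this]

theorem eq_of_le_of_card {μ ν : YoungDiagram} (h : μ ≤ ν) (hc : ν.card ≤ μ.card) : μ = ν :=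
  YoungDiagram.ext (Finset.eq_of_subset_of_card_le h hc)

theorem card_sup_add_card_inf (μ ν : YoungDiagram) :
    (μ ⊔ ν).card + (μ ⊓ ν).card = μ.card + ν.card := by
  simp only [YoungDiagram.card, YoungDiagram.cells_sup, YoungDiagram.cells_inf]
  exact Finset.card_union_add_card_inter _ _

theorem card_lt_card_of_lt {μ ν : YoungDiagram} (h : μ < ν) : μ.card < ν.card :=
  Finset.card_lt_card (YoungDiagram.cells_ssubset_iff.2 h)

open Classical in
theorem card_common_up_eq_down {n : ℕ} {μ ν : YoungDiagram} (hμ : μ.card = n + 1)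
    (hν : ν.card = n + 1) (hne : ν ≠ μ) :
    ((diagrams (n + 2)).filter (fun κ => μ ≤ κ ∧ ν ≤ κ)).card =
      ((diagrams n).filter (fun κ => κ ≤ μ ∧ κ ≤ ν)).card := by
  have hmod := card_sup_add_card_inf μ ν
  have hlt : μ.card < (μ ⊔ ν).card := by
    refine card_lt_card_of_lt (lt_of_le_of_ne le_sup_left fun h => hne ?_)
    exact eq_of_le_of_card (h ▸ le_sup_right) (by omega)
  by_cases hs : (μ ⊔ ν).card = n + 2
  · have h1 : (diagrams (n + 2)).filter (fun κ => μ ≤ κ ∧ ν ≤ κ) = {μ ⊔ ν} := by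
      ext κ
      rw [Finset.mem_filter, mem_diagrams, Finset.mem_singleton]
      constructor
      · rintro ⟨h1, h2, h3⟩
        exact (eq_of_le_of_card (sup_le h2 h3) (by omega)).symm
      · rintro rfl
        exact ⟨hs, le_sup_left, le_sup_right⟩
    have h2 : (diagrams n).filter (fun κ => κ ≤ μ ∧ κ ≤ ν) = {μ ⊓ ν} := by
      ext κ
      rw [Finset.mem_filter, mem_diagrams, Finset.mem_singleton]
      constructor
      · rintro ⟨h1, h2, h3⟩
        exact eq_of_le_of_card (le_inf h2 h3) (by omega)
      · rintro rfl
        exact ⟨by omega, inf_le_left, inf_le_right⟩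
    rw [h1, h2, Finset.card_singleton, Finset.card_singleton]
  · have h1 : (diagrams (n + 2)).filter (fun κ => μ ≤ κ ∧ ν ≤ κ) = ∅ := by
      refine Finset.filter_eq_empty_iff.2 fun κ hκ h => ?_
      rw [mem_diagrams] at hκ
      have : (μ ⊔ ν).card ≤ κ.card := Finset.card_le_card (sup_le h.1 h.2)
      omega
    have h2 : (diagrams n).filter (fun κ => κ ≤ μ ∧ κ ≤ ν) = ∅ := by
      refine Finset.filter_eq_empty_iff.2 fun κ hκ h => ?_
      rw [mem_diagrams] at hκ
      have : κ.card ≤ (μ ⊓ ν).card := Finset.card_le_card (le_inf h.1 h.2)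
      omega
    rw [h1, h2]

open Classical in
/-- The relation `(n + 1) f^μ = ∑_{μ ↗ ν} f^ν`. -/
theorem sum_numSYT_up (n : ℕ) : ∀ {μ : YoungDiagram}, μ.card = n →
    ∑ ν ∈ (diagrams (n + 1)).filter (μ ≤ ·), numSYT ν = (n + 1) * numSYT μ := by
  induction n with
  | zero =>
    intro μ hμ
    obtain rfl := eq_bot_of_card hμ
    have hd : ∀ ν ∈ (diagrams (0 + 1)).filter ((⊥ : YoungDiagram) ≤ ·), numSYT ν = 1 := by
      intro ν hν
      rw [Finset.mem_filter, mem_diagrams] at hν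
      rw [numSYT_branching 0 hν.1]
      have : (diagrams 0).filter (· ≤ ν) = {⊥} := by
        ext κ
        rw [Finset.mem_filter, mem_diagrams, Finset.mem_singleton]
        constructor
        · exact fun h => eq_bot_of_card h.1
        · rintro rfl
          exact ⟨hμ, bot_le⟩
      rw [this, Finset.sum_singleton, numSYT_bot]
    rw [Finset.sum_congr rfl hd, Finset.sum_const, card_up hμ, numSYT_bot]
    have : cornerRows (⊥ : YoungDiagram) = ∅ := by simp [cornerRows]
    simp [this]
  | succ n ih =>
    intro μ hμ
    have hU : ∑ ν ∈ (diagrams (n + 1 + 1)).filter (μ ≤ ·), numSYT ν =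
        ∑ κ ∈ diagrams (n + 1),
          ((diagrams (n + 2)).filter (fun ν => μ ≤ ν ∧ κ ≤ ν)).card * numSYT κ := by
      rw [Finset.sum_congr rfl (fun ν hν =>
        numSYT_branching (n + 1) (mem_diagrams.1 (Finset.mem_filter.1 hν).1))]
      simp only [Finset.sum_filter]
      simp only [Finset.card_filter, Finset.sum_mul, ite_mul, one_mul, zero_mul]
      rw [Finset.sum_comm (s := diagrams (n + 1))]
      refine Finset.sum_congr rfl fun ν _ => ?_
      by_cases h : μ ≤ ν <;> simp [h]
    have hD : ∑ κ ∈ (diagrams n).filter (· ≤ μ), (n + 1) * numSYT κ =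
        ∑ κ ∈ diagrams (n + 1),
          ((diagrams n).filter (fun ν => ν ≤ μ ∧ ν ≤ κ)).card * numSYT κ := by
      rw [Finset.sum_congr rfl (fun κ hκ =>
        (ih (mem_diagrams.1 (Finset.mem_filter.1 hκ).1)).symm)]
      simp only [Finset.sum_filter]
      simp only [Finset.card_filter, Finset.sum_mul, ite_mul, one_mul, zero_mul]
      rw [Finset.sum_comm (s := diagrams (n + 1))]
      refine Finset.sum_congr rfl fun ν _ => ?_
      by_cases h : ν ≤ μ <;> simp [h]
    have hmem : μ ∈ diagrams (n + 1) := mem_diagrams.2 hμ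
    rw [← Finset.mul_sum, ← numSYT_branching n hμ] at hD
    rw [hU, ← Finset.add_sum_erase _ _ hmem]
    rw [← Finset.add_sum_erase _ _ hmem] at hD
    simp only [and_self] at hD ⊢
    rw [card_up hμ]
    rw [card_down hμ] at hD
    rw [Finset.sum_congr rfl (fun κ hκ => by
      rw [card_common_up_eq_down hμ (mem_diagrams.1 (Finset.mem_of_mem_erase hκ))
        (Finset.ne_of_mem_erase hκ)])]
    linarith

theorem numSYT_pos (μ : YoungDiagram) : 0 < numSYT μ := by
  classical
  induction h : μ.card generalizing μ with
  | zero => rw [eq_bot_of_card h, numSYT_bot]; exact one_pos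
  | succ n ih =>
    rw [numSYT_branching n h]
    refine Finset.sum_pos (fun κ hκ => ih κ (mem_diagrams.1 (Finset.mem_filter.1 hκ).1)) ?_
    rw [← Finset.card_pos, card_down h, Finset.card_pos]
    by_contra hne
    rw [Finset.not_nonempty_iff_eq_empty] at hne
    have hconst : ∀ i, μ.rowLen 0 ≤ μ.rowLen i := fun i => by
      induction i with
      | zero => exact le_rfl
      | succ k ihk =>
        have : k ∉ cornerRows μ := by simp [hne]
        rw [mem_cornerRows] at this
        omega
    obtain ⟨k, hk⟩ := μ.exists_notMem_col 0
    rw [YoungDiagram.mem_cells, YoungDiagram.mem_iff_lt_rowLen] at hk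
    have h0 : μ.rowLen 0 = 0 := by have := hconst k; omega
    obtain ⟨⟨a, b⟩, hab⟩ : μ.cells.Nonempty := by
      rw [← Finset.card_pos]
      have : μ.cells.card = n + 1 := h
      omega
    have h1 := YoungDiagram.mem_iff_lt_rowLen.1 hab
    have := μ.rowLen_anti 0 a (Nat.zero_le _)
    omega


/-! ### The Plancherel growth process -/

open Classical in
/-- Transition probabilities of the Plancherel growth process: from `μ` with `n` boxes to `ν` with
probability `f^ν / ((n + 1) f^μ)` if `μ ↗ ν`, and `0` otherwise. -/
noncomputable def transitionProb (μ ν : YoungDiagram) : ℝ≥0∞ :=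
  if Adds μ ν then (numSYT ν : ℝ≥0∞) / (((μ.card + 1 : ℕ) : ℝ≥0∞) * (numSYT μ : ℝ≥0∞)) else 0

theorem hasSum_transitionProb (μ : YoungDiagram) : HasSum (transitionProb μ) 1 := by
  classical
  have hz : ∀ ν, ν ∉ (diagrams (μ.card + 1)).filter (μ ≤ ·) → transitionProb μ ν = 0 := by
    intro ν hν
    rw [Finset.mem_filter, mem_diagrams] at hν
    exact if_neg fun h => hν ⟨h.2, h.1⟩
  have hsum : ∑ ν ∈ (diagrams (μ.card + 1)).filter (μ ≤ ·), transitionProb μ ν = 1 := by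
    have h1 : ∀ ν ∈ (diagrams (μ.card + 1)).filter (μ ≤ ·), transitionProb μ ν =
        (numSYT ν : ℝ≥0∞) * (((μ.card + 1 : ℕ) : ℝ≥0∞) * (numSYT μ : ℝ≥0∞))⁻¹ := by
      intro ν hν
      rw [Finset.mem_filter, mem_diagrams] at hν
      rw [transitionProb, if_pos ⟨hν.2, hν.1⟩, div_eq_mul_inv]
    rw [Finset.sum_congr rfl h1, ← Finset.sum_mul, ← Nat.cast_sum, sum_numSYT_up _ rfl,
      ← Nat.cast_mul]
    refine ENNReal.mul_inv_cancel ?_ (ENNReal.natCast_ne_top _)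
    have := numSYT_pos μ
    exact_mod_cast (by positivity : (μ.card + 1) * numSYT μ ≠ 0)
  rw [← hsum]
  exact hasSum_sum_of_ne_finset_zero hz

instance : MeasurableSpace YoungDiagram := ⊤

instance : DiscreteMeasurableSpace YoungDiagram := ⟨fun _ => trivial⟩

instance : Countable YoungDiagram :=
  Function.Injective.countable (f := YoungDiagram.cells) fun _ _ h => YoungDiagram.ext h

/-- The distribution of the diagram that follows `μ` in the Plancherel growth process. -/
noncomputable def transitionPMF (μ : YoungDiagram) : PMF YoungDiagram :=
  ⟨transitionProb μ, hasSum_transitionProb μ⟩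

/-- The Markov kernel of the Plancherel growth process. -/
noncomputable def transitionKernel : Kernel YoungDiagram YoungDiagram :=
  Kernel.ofFunOfCountable fun μ => (transitionPMF μ).toMeasure

instance : IsMarkovKernel transitionKernel :=
  ⟨fun μ => inferInstanceAs (IsProbabilityMeasure (transitionPMF μ).toMeasure)⟩

/-- The transition kernels as functions of the whole history, which only use the present state. -/
noncomputable def historyKernel (n : ℕ) :
    Kernel ((i : Finset.Iic n) → (fun _ : ℕ => YoungDiagram) i) YoungDiagram :=
  transitionKernel.comap (fun h => h ⟨n, Finset.mem_Iic.2 le_rfl⟩) (measurable_pi_apply _)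

instance (n : ℕ) : IsMarkovKernel (historyKernel n) := by
  unfold historyKernel; infer_instance

/-- The law, on sequences of diagrams, of the Plancherel growth process `∅ = Λ₀ ↗ Λ₁ ↗ Λ₂ ↗ ⋯`:
the Markov chain started at the empty diagram with the above transition probabilities. -/
noncomputable def plancherelGrowth : Measure (ℕ → YoungDiagram) :=
  Kernel.trajMeasure (X := fun _ => YoungDiagram) (Measure.dirac ⊥) historyKernel

/-! ### Infinite Young tableaux -/

/-- An infinite Young tableau: a filling of the boxes of the quadrant by the numbers `1, 2, 3, …`,
each appearing exactly once, increasing along rows and columns. Boxes are indexed from `(0, 0)`;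
the first coordinate is the row and the second the column, as for `YoungDiagram`. -/
@[ext]
structure InfiniteTableau where
  entry : ℕ × ℕ → ℕ
  bijOn : Set.BijOn entry Set.univ (Set.Ici 1)
  row_lt : ∀ i j, entry (i, j) < entry (i, j + 1)
  col_lt : ∀ i j, entry (i, j) < entry (i + 1, j)

namespace InfiniteTableau

/-- The smallest σ-algebra making all coordinates `t ↦ t_{i,j}` measurable. -/
instance : MeasurableSpace InfiniteTableau :=
  ⨆ c : ℕ × ℕ, MeasurableSpace.comap (fun t : InfiniteTableau => t.entry c) ⊤

instance : Inhabited InfiniteTableau where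
  default :=
    { entry := fun c => Nat.pair c.1 c.2 + 1
      bijOn := by
        refine ⟨fun c _ => ?_, fun c _ d _ h => ?_, fun n hn => ?_⟩
        · simp
        · have h1 : Nat.pair c.1 c.2 = Nat.pair d.1 d.2 := by simpa using h
          obtain ⟨h2, h3⟩ := Nat.pair_eq_pair.1 h1
          exact Prod.ext h2 h3
        · refine ⟨Nat.unpair (n - 1), trivial, ?_⟩
          have : 1 ≤ n := hn
          simp only [Nat.pair_unpair]
          omega
      row_lt := fun i j => Nat.succ_lt_succ (Nat.pair_lt_pair_right i (Nat.lt_succ_self j))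
      col_lt := fun i j => Nat.succ_lt_succ (Nat.pair_lt_pair_left j (Nat.lt_succ_self i)) }

variable (t : InfiniteTableau)

theorem injective : Function.Injective t.entry := fun _ _ h =>
  t.bijOn.injOn trivial trivial h

theorem one_le (c : ℕ × ℕ) : 1 ≤ t.entry c := t.bijOn.mapsTo trivial

theorem mono {c d : ℕ × ℕ} (h : c ≤ d) : t.entry c ≤ t.entry d := by
  obtain ⟨i, j⟩ := c
  obtain ⟨i', j'⟩ := d
  obtain ⟨hi, hj⟩ := Prod.mk_le_mk.1 h
  have h1 : Monotone fun a => t.entry (a, j) := monotone_nat_of_le_succ fun a => (t.col_lt a j).le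
  have h2 : Monotone fun b => t.entry (i', b) := monotone_nat_of_le_succ fun b => (t.row_lt i' b).le
  exact (h1 hi).trans (h2 hj)

theorem finite_le (n : ℕ) : {c | t.entry c ≤ n}.Finite :=
  Set.Finite.preimage t.injective.injOn (Set.finite_Iic n)

/-- The diagram `Λ_n` consisting of the boxes of `t` with entry at most `n`. -/
noncomputable def shape (n : ℕ) : YoungDiagram where
  cells := (t.finite_le n).toFinset
  isLowerSet := by
    intro c d h hc
    simp only [Set.Finite.coe_toFinset, Set.mem_ofPred_eq] at hc ⊢
    exact (t.mono h).trans hc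

/-- The path in the Young graph of which `t` is the recording tableau. -/
noncomputable def shapePath : ℕ → YoungDiagram := fun n => t.shape n

/-! ### Jeu de taquin -/

/-- The jeu de taquin path of `t`: start at the corner and always step to that one of the two
neighbouring boxes (next row or next column) whose entry is smaller. -/
def jdtPath : ℕ → ℕ × ℕ
  | 0 => (0, 0)
  | k + 1 =>
    let c := jdtPath k
    if t.entry (c.1 + 1, c.2) < t.entry (c.1, c.2 + 1) then (c.1 + 1, c.2) else (c.1, c.2 + 1)

open Classical in
/-- The entries of `J(t)`: at the `k`-th box of the jeu de taquin path it is the entry of `t` at the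
`(k+1)`-st box of the path, minus one; elsewhere it is the entry of `t` minus one. -/
noncomputable def jdtEntry (c : ℕ × ℕ) : ℕ :=
  if h : ∃ k, t.jdtPath k = c then t.entry (t.jdtPath (h.choose + 1)) - 1 else t.entry c - 1

theorem jdtPath_sum (k : ℕ) : (t.jdtPath k).1 + (t.jdtPath k).2 = k := by
  induction k with
  | zero => rfl
  | succ k ih =>
    rw [jdtPath]
    split_ifs <;> simp only <;> omega

theorem jdtPath_injective : Function.Injective t.jdtPath := fun k l h => by
  rw [← t.jdtPath_sum k, ← t.jdtPath_sum l, h]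

theorem jdtEntry_path (k : ℕ) : t.jdtEntry (t.jdtPath k) = t.entry (t.jdtPath (k + 1)) - 1 := by
  have h : ∃ l, t.jdtPath l = t.jdtPath k := ⟨k, rfl⟩
  rw [jdtEntry, dif_pos h, t.jdtPath_injective h.choose_spec]

theorem jdtEntry_off {c : ℕ × ℕ} (hc : ∀ k, t.jdtPath k ≠ c) : t.jdtEntry c = t.entry c - 1 :=
  dif_neg fun ⟨k, hk⟩ => hc k hk

theorem entry_jdtPath_succ_le_row (k : ℕ) :
    t.entry (t.jdtPath (k + 1)) ≤ t.entry ((t.jdtPath k).1, (t.jdtPath k).2 + 1) := by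
  rw [jdtPath]
  split_ifs with h
  · exact h.le
  · exact le_rfl

theorem entry_jdtPath_succ_le_col (k : ℕ) :
    t.entry (t.jdtPath (k + 1)) ≤ t.entry ((t.jdtPath k).1 + 1, (t.jdtPath k).2) := by
  rw [jdtPath]
  split_ifs with h
  · exact le_rfl
  · exact not_lt.1 h

theorem entry_jdtPath_lt (k : ℕ) : t.entry (t.jdtPath k) < t.entry (t.jdtPath (k + 1)) := by
  conv_rhs => rw [jdtPath]
  split_ifs with h
  · exact t.col_lt _ _
  · exact t.row_lt _ _

theorem entry_zero_lt {c : ℕ × ℕ} (hc : c ≠ (0, 0)) : t.entry (0, 0) < t.entry c :=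
  lt_of_le_of_ne (t.mono ⟨Nat.zero_le _, Nat.zero_le _⟩) fun h => hc (t.injective h).symm

theorem entry_zero : t.entry (0, 0) = 1 := by
  obtain ⟨c, -, hc⟩ := t.bijOn.surjOn (Set.mem_Ici.2 (le_refl 1))
  by_contra hne
  have h1 : c ≠ (0, 0) := fun h => hne (h ▸ hc)
  have h2 := t.entry_zero_lt h1
  have h3 := t.one_le (0, 0)
  omega

/-- `J(t)_c + 1` is the entry of `t` at some box other than the corner. -/
theorem exists_source (c : ℕ × ℕ) :
    ∃ d, d ≠ (0, 0) ∧ t.jdtEntry c + 1 = t.entry d ∧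
      ((∃ k, t.jdtPath k = c ∧ t.jdtPath (k + 1) = d) ∨ ((∀ k, t.jdtPath k ≠ c) ∧ d = c)) := by
  by_cases h : ∃ k, t.jdtPath k = c
  · obtain ⟨k, rfl⟩ := h
    refine ⟨t.jdtPath (k + 1), fun h0 => ?_, ?_, Or.inl ⟨k, rfl, rfl⟩⟩
    · have := t.jdtPath_sum (k + 1)
      rw [h0] at this
      simp at this
    · rw [t.jdtEntry_path]
      have := t.one_le (t.jdtPath (k + 1))
      omega
  · push Not at h
    refine ⟨c, fun h0 => h 0 h0.symm, ?_, Or.inr ⟨h, rfl⟩⟩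
    rw [t.jdtEntry_off h]
    have := t.one_le c
    omega

theorem le_jdtEntry (c : ℕ × ℕ) : t.entry c ≤ t.jdtEntry c + 1 := by
  obtain ⟨d, -, h, ⟨k, rfl, rfl⟩ | ⟨-, rfl⟩⟩ := t.exists_source c
  · rw [h]; exact (t.entry_jdtPath_lt k).le
  · exact h.ge

theorem jdtEntry_lt_of {c d : ℕ × ℕ} (hlt : t.entry c < t.entry d)
    (hp : ∀ k, t.jdtPath k = c → t.entry (t.jdtPath (k + 1)) ≤ t.entry d) :
    t.jdtEntry c < t.jdtEntry d := by
  have hd := t.le_jdtEntry d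
  obtain ⟨e, -, h, ⟨k, rfl, rfl⟩ | ⟨-, rfl⟩⟩ := t.exists_source c
  · have h1 := hp k rfl
    rcases eq_or_lt_of_le h1 with h2 | h2
    · obtain rfl := t.injective h2
      rw [t.jdtEntry_path (k + 1)]
      have := t.entry_jdtPath_lt (k + 1)
      omega
    · omega
  · omega

/-- The jeu de taquin map `J` on infinite Young tableaux. -/
noncomputable def jdt : InfiniteTableau where
  entry := t.jdtEntry
  bijOn := by
    refine ⟨fun c _ => ?_, fun c _ c' _ h => ?_, fun n hn => ?_⟩
    · obtain ⟨d, hd, h, -⟩ := t.exists_source c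
      have := t.entry_zero_lt hd
      rw [t.entry_zero] at this
      exact Set.mem_Ici.2 (by omega)
    · obtain ⟨d, -, h1, h2⟩ := t.exists_source c
      obtain ⟨d', -, h1', h2'⟩ := t.exists_source c'
      obtain rfl : d = d' := t.injective (by rw [← h1, ← h1', h])
      rcases h2 with ⟨k, rfl, hk⟩ | ⟨hk, rfl⟩ <;> rcases h2' with ⟨l, rfl, hl⟩ | ⟨hl, hd⟩
      · have := t.jdtPath_injective (hk.trans hl.symm)
        obtain rfl : k = l := by omega
        rfl
      · exact absurd (hk.trans hd) (hl _)
      · exact absurd hl (hk _)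
      · exact hd
    · have hn' : 1 ≤ n := hn
      obtain ⟨d, -, hd⟩ := t.bijOn.surjOn (Set.mem_Ici.2 (Nat.le_add_left 1 n))
      by_cases h : ∃ k, t.jdtPath k = d
      · obtain ⟨k, rfl⟩ := h
        rcases k with _ | k
        · have h0 : t.entry (0, 0) = n + 1 := hd
          rw [t.entry_zero] at h0
          omega
        · exact ⟨t.jdtPath k, trivial, by rw [t.jdtEntry_path, hd]; rfl⟩
      · push Not at h
        exact ⟨d, trivial, by rw [t.jdtEntry_off h, hd]; rfl⟩
  row_lt := fun i j => t.jdtEntry_lt_of (t.row_lt i j) fun k hk => by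
    have := t.entry_jdtPath_succ_le_row k
    rwa [hk] at this
  col_lt := fun i j => t.jdtEntry_lt_of (t.col_lt i j) fun k hk => by
    have := t.entry_jdtPath_succ_le_col k
    rwa [hk] at this

end InfiniteTableau

/-- The Plancherel measure `P` on infinite Young tableaux: the law of the Plancherel growth process,
transported along the identification of infinite tableaux with the paths in the Young graph which
start at the empty diagram and eventually contain every box. -/
noncomputable def plancherelMeasure : Measure InfiniteTableau :=
  plancherelGrowth.comap InfiniteTableau.shapePath

/-! ### The infinite Robinson–Schensted–Knuth map -/

section RSK

variable {α : Type*} [LinearOrder α]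

/-- Insert `x` into an increasing row: `x` replaces the first entry larger than `x`, which is bumped
out (second component of the result); if there is none, `x` is appended to the row. -/
def rowInsert (x : α) : List α → List α × Option α
  | [] => ([x], none)
  | y :: r =>
    if x < y then (x :: r, some y) else (y :: (rowInsert x r).1, (rowInsert x r).2)

/-- Row insertion of `x` into a tableau, given as the list of its rows: insert `x` into the first
row, the bumped entry into the second row, and so on. -/
def insertStep (x : α) : List (List α) → List (List α)
  | [] => [[x]]
  | r :: P =>
    match (rowInsert x r).2 with
    | none => (rowInsert x r).1 :: P
    | some y => (rowInsert x r).1 :: insertStep y P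

/-- The insertion tableau `P_n` of the first `n` terms of the sequence `x`. -/
def insertionTableau (x : ℕ → α) : ℕ → List (List α)
  | 0 => []
  | n + 1 => insertStep (x n) (insertionTableau x n)

/-- The boxes of the RSK shape `λ_n` associated with the first `n` terms of the sequence `x`. -/
def rskShape (x : ℕ → α) (n : ℕ) : Set (ℕ × ℕ) :=
  {c | c.2 < ((insertionTableau x n).getD c.1 []).length}

/-- `t` is the infinite recording tableau of `x`: for every `n`, the boxes of `t` with entry at
most `n` are those of the RSK shape `λ_n`. -/
def IsRecordingTableau (x : ℕ → α) (t : InfiniteTableau) : Prop :=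
  ∀ n c, t.entry c ≤ n ↔ c ∈ rskShape x n

/-- The sequences on which the infinite RSK map is defined: the terms are distinct and the path of
RSK shapes has an infinite recording tableau. -/
def rskDomain : Set (ℕ → α) :=
  {x | Function.Injective x ∧ ∃ t, IsRecordingTableau x t}

open Classical in
/-- The infinite RSK map, sending a sequence in `rskDomain` to its infinite recording tableau (and
any other sequence to a fixed arbitrary tableau). -/
noncomputable def rsk (x : ℕ → α) : InfiniteTableau :=
  if h : x ∈ rskDomain then h.2.choose else default

end RSK

/-- The product measure `Leb^{⊗ℕ}` on `[0,1]^ℕ`. -/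
noncomputable def lebProduct : Measure (ℕ → unitInterval) :=
  Measure.infinitePi fun _ => (volume : Measure unitInterval)

/-- The one-sided shift `S(x₁, x₂, …) = (x₂, x₃, …)`. -/
def shift {α : Type*} (x : ℕ → α) : ℕ → α := fun n => x (n + 1)

end JeuDeTaquin

/-!
The shapes of a word without repetitions change under deletion of its first letter by the local
rule of jeu de taquin. This is proved by deleting the largest letter: the shapes with and without
the first, the last and the largest letter form a cube in which the faces around the largest letter
follow the local rules of row and column insertion, and the rule for the shorter words forces the
rule for the longer ones. Read along an infinite sequence, the local rule says that the last box
added by deleting the first letter walks along the jeu de taquin path of the recording tableau,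
that is, `J ∘ RSK = RSK ∘ S`.

The RSK shapes `λ_1, …, λ_n` of a sequence depend only on the relative order of its first `n` terms.
By the Robinson–Schensted correspondence at most `f^μ` permutations have a given path of shapes from
`∅` to `μ`, and under an atomless i.i.d. law each order has probability at most `1 / n!`. So a path
has at most its probability `f^μ / n!` under the Plancherel growth process, and since both laws have
total mass one, they agree.

Passing from `x` to `S x` only removes boxes from the shapes, so the event that a given box is ever
filled has probability `0` or `1` by ergodicity of the shift; its probability is positive, hence
`1`. Almost every sequence therefore has a recording tableau, and measure preservation and
ergodicity pass from the shift to its factor `J`.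
-/

namespace JeuDeTaquin

/-! ### Local rules for shapes -/

/-- The row lengths obtained from `l` by adding a box at the end of row `p`. Shapes are handled as
functions giving the length of each row, so that no condition on `p` is needed. -/
def bump (l : ℕ → ℕ) (p i : ℕ) : ℕ := l i + if i = p then 1 else 0

/-- The row containing the largest letter, formerly at the end of row `v`, after an insertion that
ends in row `b` if the largest letter is ignored: it is bumped to the next row if `b = v`. -/
def displace (b v : ℕ) : ℕ := if b = v then v + 1 else v

/-- The local rule of row insertion: `m` is obtained from `l`, and `m'` from `l'`, by adding the
largest letter, while the steps from `l` to `l'` and from `m` to `m'` insert the same letter. -/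
def RowSquare (l l' m m' : ℕ → ℕ) : Prop :=
  ∃ b v, l' = bump l b ∧ m = bump l v ∧ m' = bump l' (displace b v)

/-- The local rule of column insertion: the steps from `l` to `A` and from `l'` to `A'` insert the
same letter, while `l'` is obtained from `l`, and `A'` from `A`, by adding the largest letter. The
condition for `c = v` says that the largest letter is bumped to the next column. -/
def ColSquare (l A l' A' : ℕ → ℕ) : Prop :=
  ∃ c v f, A = bump l c ∧ l' = bump l v ∧ A' = bump A f ∧
    (c ≠ v → f = v) ∧ (c = v → bump l c f = l c + 1)

/-- The local rule of jeu de taquin: the box of `A` outside `l` stays in place unless `l'` contains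
it, in which case it moves to an adjacent box. -/
def JdtSquare (l A l' A' : ℕ → ℕ) : Prop :=
  ∃ c b d, A = bump l c ∧ l' = bump l b ∧ A' = bump A d ∧
    (b ≠ c → d = b) ∧ (b = c → d = c ∨ d = c + 1 ∧ l (c + 1) = l c)

theorem bump_comm (l : ℕ → ℕ) (p q : ℕ) : bump (bump l p) q = bump (bump l q) p := by
  funext i
  simp only [bump]
  omega

theorem bump_injective (l : ℕ → ℕ) : Function.Injective (bump l) := by
  intro p q h
  by_contra hne
  simpa [bump, hne] using congrFun h p

theorem lt_of_antitone_bump {l : ℕ → ℕ} {p i : ℕ} (h : Antitone (bump l p)) (hi : i < p) :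
    l p < l i := by
  have := h hi.le
  simp only [bump, if_pos, if_neg hi.ne] at this
  omega

theorem antitone_bump_zero {l : ℕ → ℕ} (h : Antitone l) : Antitone (bump l 0) := by
  refine antitone_nat_of_succ_le fun i => ?_
  have := h (Nat.le_succ i)
  simp only [bump]
  grind

theorem bump_bump_displace (l : ℕ → ℕ) (b v : ℕ) :
    bump (bump l b) (displace b v) = bump (bump l v) (displace v b) := by
  rcases eq_or_ne b v with rfl | h
  · rfl
  · rw [displace, displace, if_neg h, if_neg h.symm, bump_comm]

theorem ColSquare.bump_eq {l : ℕ → ℕ} {c v f : ℕ} (h : c ≠ v → f = v) :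
    bump (bump l c) f = bump (bump l v) (if c = v then f else c) := by
  split_ifs with hcv
  · rw [hcv]
  · rw [h hcv, bump_comm]

theorem RowSquare.antitone {l l' m m' : ℕ → ℕ} (h : RowSquare l l' m m') (hl : Antitone l)
    (hl' : Antitone l') (hm : Antitone m) : Antitone m' := by
  obtain ⟨b, v, rfl, rfl, rfl⟩ := h
  refine antitone_nat_of_succ_le fun i => ?_
  have hi := hl (Nat.le_succ i)
  have hi' := hl' (Nat.le_succ i)
  have him := hm (Nat.le_succ i)
  simp only [bump, displace, Nat.succ_eq_add_one] at *
  grind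

theorem JdtSquare.exists_bump {l A l' A' : ℕ → ℕ} (h : JdtSquare l A l' A') :
    ∃ c, A' = bump l' c := by
  obtain ⟨c, b, d, rfl, rfl, rfl, hd, -⟩ := h
  exact ⟨_, ColSquare.bump_eq fun h => hd h.symm⟩

theorem RowSquare.eq_bump_displace {l m' : ℕ → ℕ} {b v : ℕ}
    (h : RowSquare l (bump l b) (bump l v) m') : m' = bump (bump l b) (displace b v) := by
  obtain ⟨b', v', hb, hv, rfl⟩ := h
  rw [bump_injective l hb, bump_injective l hv]

section Cube

/-! In a cube whose edges add boxes and whose two faces `l l' m m'` and `A A' B B'` follow the rule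
of row insertion, faces `l A l' A'` for jeu de taquin and `l A m B` for column insertion force
their opposite faces to be of the same kind. -/

variable {l l' m m' A A' B B' : ℕ → ℕ}

theorem JdtSquare.opposite (hl : Antitone l) (hm : Antitone m)
    (hA' : Antitone A') (hB : Antitone B) (hJ : JdtSquare l A l' A') (hC : ColSquare l A m B)
    (hrow : RowSquare l l' m m') (hrowA : RowSquare A A' B B') : JdtSquare m B m' B' := by
  obtain ⟨c, b, d, rfl, rfl, rfl, hbc, hbc'⟩ := hJ
  obtain ⟨_, v, f, hc, rfl, rfl, hcv, hcv'⟩ := hC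
  obtain rfl := bump_injective _ hc
  obtain rfl := hrow.eq_bump_displace
  obtain rfl := hrowA.eq_bump_displace
  refine ⟨if c = v then f else c, displace v b, displace f d, ColSquare.bump_eq hcv,
    bump_bump_displace .., bump_bump_displace .., ?_⟩
  have hl_succ := fun i => hl (Nat.le_succ i)
  have hv_lt := fun i => lt_of_antitone_bump hm (i := i)
  have hd_lt := fun i => lt_of_antitone_bump hA' (i := i)
  have hf_lt := fun i => lt_of_antitone_bump hB (i := i)
  simp only [bump, displace, Nat.succ_eq_add_one] at *
  grind

theorem ColSquare.opposite (hl : Antitone l) (hm : Antitone m)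
    (hA' : Antitone A') (hB : Antitone B) (hJ : JdtSquare l A l' A') (hC : ColSquare l A m B)
    (hrow : RowSquare l l' m m') (hrowA : RowSquare A A' B B') : ColSquare l' A' m' B' := by
  obtain ⟨c, b, d, rfl, rfl, rfl, hbc, hbc'⟩ := hJ
  obtain ⟨_, v, f, hc, rfl, rfl, hcv, hcv'⟩ := hC
  obtain rfl := bump_injective _ hc
  obtain rfl := hrow.eq_bump_displace
  obtain rfl := hrowA.eq_bump_displace
  refine ⟨if c = b then d else c, displace b v, displace d f,
    ColSquare.bump_eq fun h => hbc h.symm, rfl, rfl, ?_⟩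
  have hl_succ := fun i => hl (Nat.le_succ i)
  have hv_lt := fun i => lt_of_antitone_bump hm (i := i)
  have hd_lt := fun i => lt_of_antitone_bump hA' (i := i)
  have hf_lt := fun i => lt_of_antitone_bump hB (i := i)
  simp only [bump, displace, Nat.succ_eq_add_one] at *
  grind

end Cube

/-! ### Row insertion and the largest letter -/

section Insertion

variable {α : Type*}

/-- The lengths of the rows of a tableau given as the list of its rows. -/
def rowLens (T : List (List α)) (i : ℕ) : ℕ := (T.getD i []).length

@[simp] theorem rowLens_nil (i : ℕ) : rowLens ([] : List (List α)) i = 0 := rfl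

@[simp] theorem rowLens_cons_zero (r : List α) (T : List (List α)) :
    rowLens (r :: T) 0 = r.length := rfl

@[simp] theorem rowLens_cons_succ (r : List α) (T : List (List α)) (i : ℕ) :
    rowLens (r :: T) (i + 1) = rowLens T i := rfl

/-- The tableau obtained from a tableau by appending `m` to row `p`. -/
def addAt (m : α) : ℕ → List (List α) → List (List α)
  | 0, [] => [[m]]
  | 0, r :: T => (r ++ [m]) :: T
  | p + 1, [] => [] :: addAt m p []
  | p + 1, r :: T => r :: addAt m p T

theorem rowLens_addAt (m : α) (p : ℕ) (T : List (List α)) :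
    rowLens (addAt m p T) = bump (rowLens T) p := by
  induction p generalizing T with
  | zero =>
    funext i
    cases T <;> cases i <;> simp [addAt, bump]
  | succ p ih =>
    funext i
    cases T <;> cases i <;> simp [addAt, bump, ih]

variable [LinearOrder α]

theorem rowInsert_of_none {y : α} {r : List α} (h : (rowInsert y r).2 = none) :
    (rowInsert y r).1 = r ++ [y] := by
  induction r with
  | nil => rfl
  | cons a r ih =>
    rw [rowInsert] at h ⊢
    split_ifs at h ⊢
    simp_all

theorem exists_rowInsert_of_some {y z : α} {r : List α} (h : (rowInsert y r).2 = some z) :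
    ∃ s t, r = s ++ z :: t ∧ (rowInsert y r).1 = s ++ y :: t ∧ y < z ∧ ∀ a ∈ s, a ≤ y := by
  induction r with
  | nil => simp [rowInsert] at h
  | cons a r ih =>
    rw [rowInsert] at h ⊢
    split_ifs at h ⊢ with hlt
    · obtain rfl : a = z := by simpa using h
      exact ⟨[], r, rfl, rfl, hlt, by simp⟩
    · obtain ⟨s, t, hr, hr', hyz, hs⟩ := ih h
      refine ⟨a :: s, t, by simp [← hr], by simp [hr'], hyz, ?_⟩
      simpa using ⟨not_lt.1 hlt, hs⟩

theorem rowInsert_of_forall_lt {m : α} {r : List α} (h : ∀ a ∈ r, a < m) :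
    rowInsert m r = (r ++ [m], none) := by
  induction r with
  | nil => rfl
  | cons a r ih =>
    simp only [List.mem_cons, forall_eq_or_imp] at h
    rw [rowInsert, if_neg h.1.not_gt, ih h.2, List.cons_append]

theorem rowInsert_append_of_none {y m : α} {r : List α} (hy : y < m)
    (h : (rowInsert y r).2 = none) : rowInsert y (r ++ [m]) = (r ++ [y], some m) := by
  induction r with
  | nil => simp [rowInsert, hy]
  | cons a r ih =>
    rw [rowInsert] at h
    rw [List.cons_append, rowInsert]
    split_ifs at h ⊢
    simp [ih h]

theorem rowInsert_append_of_some {y z : α} {r : List α} (h : (rowInsert y r).2 = some z)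
    (m : α) : rowInsert y (r ++ [m]) = ((rowInsert y r).1 ++ [m], some z) := by
  induction r with
  | nil => simp [rowInsert] at h
  | cons a r ih =>
    rw [rowInsert] at h ⊢
    rw [List.cons_append, rowInsert]
    split_ifs at h ⊢
    · simp_all
    · simp [ih h]

theorem insertStep_cons_of_none {y : α} {r : List α} (h : (rowInsert y r).2 = none)
    (T : List (List α)) : insertStep y (r :: T) = (r ++ [y]) :: T := by
  rw [insertStep, h, rowInsert_of_none h]

theorem insertStep_cons_of_some {y z : α} {r : List α} (h : (rowInsert y r).2 = some z)
    (T : List (List α)) : insertStep y (r :: T) = (rowInsert y r).1 :: insertStep z T := by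
  rw [insertStep, h]

/-- The row in which the insertion of a letter into a tableau ends. -/
def insertRow : α → List (List α) → ℕ
  | _, [] => 0
  | y, r :: T =>
    match (rowInsert y r).2 with
    | none => 0
    | some z => insertRow z T + 1

theorem insertRow_cons_of_none {y : α} {r : List α} (h : (rowInsert y r).2 = none)
    (T : List (List α)) : insertRow y (r :: T) = 0 := by
  rw [insertRow, h]

theorem insertRow_cons_of_some {y z : α} {r : List α} (h : (rowInsert y r).2 = some z)
    (T : List (List α)) : insertRow y (r :: T) = insertRow z T + 1 := by
  rw [insertRow, h]

theorem rowLens_insertStep (y : α) (T : List (List α)) :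
    rowLens (insertStep y T) = bump (rowLens T) (insertRow y T) := by
  induction T generalizing y with
  | nil =>
    funext i
    cases i <;> simp [insertStep, insertRow, bump]
  | cons r T ih =>
    funext i
    rcases hz : (rowInsert y r).2 with _ | z
    · rw [insertStep_cons_of_none hz, insertRow_cons_of_none hz]
      cases i <;> simp [bump]
    · obtain ⟨s, t, hr, hr', -, -⟩ := exists_rowInsert_of_some hz
      rw [insertStep_cons_of_some hz, insertRow_cons_of_some hz]
      cases i with
      | zero =>
        rw [rowLens_cons_zero, hr']
        simp [bump, hr]
      | succ i => simp [bump, ih]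

theorem flatten_insertStep_perm (y : α) (T : List (List α)) :
    (insertStep y T).flatten.Perm (y :: T.flatten) := by
  induction T generalizing y with
  | nil => rfl
  | cons r T ih =>
    rw [List.flatten_cons]
    rcases hz : (rowInsert y r).2 with _ | z
    · rw [insertStep_cons_of_none hz, List.flatten_cons, List.append_assoc]
      exact List.perm_middle
    · obtain ⟨s, t, hr, hr', -, -⟩ := exists_rowInsert_of_some hz
      rw [insertStep_cons_of_some hz, List.flatten_cons, hr', hr]
      refine ((ih z).append_left _).trans ?_
      simp only [List.perm_iff_count, List.count_append, List.count_cons]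
      intro a
      omega

theorem insertStep_of_forall_lt {m : α} {T : List (List α)} (h : ∀ a ∈ T.flatten, a < m) :
    insertStep m T = addAt m 0 T := by
  cases T with
  | nil => rfl
  | cons r T =>
    have hr := rowInsert_of_forall_lt fun a (ha : a ∈ r) => h a (by simp [ha])
    rw [insertStep_cons_of_none (by rw [hr]), addAt]

theorem insertStep_addAt {m y : α} (hy : y < m) {T : List (List α)}
    (h : ∀ a ∈ T.flatten, a < m) (p : ℕ) :
    insertStep y (addAt m p T) = addAt m (displace (insertRow y T) p) (insertStep y T) := by
  induction T generalizing y p with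
  | nil =>
    cases p with
    | zero =>
      have hym : rowInsert y [m] = ([y], some m) := by simp [rowInsert, hy]
      simp [addAt, insertStep, insertRow, displace, hym]
    | succ p => simp [addAt, insertStep, insertRow, displace, rowInsert]
  | cons r T ih =>
    simp only [List.flatten_cons, List.mem_append, or_imp, forall_and] at h
    rcases hz : (rowInsert y r).2 with _ | z
    · rw [insertStep_cons_of_none hz, insertRow_cons_of_none hz]
      cases p with
      | zero =>
        have hm := rowInsert_append_of_none hy hz
        rw [addAt, insertStep_cons_of_some (by rw [hm]), hm, insertStep_of_forall_lt h.2]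
        simp [addAt, displace]
      | succ p =>
        rw [addAt, insertStep_cons_of_none hz]
        simp [addAt, displace]
    · rw [insertStep_cons_of_some hz, insertRow_cons_of_some hz]
      cases p with
      | zero =>
        have hm := rowInsert_append_of_some hz m
        rw [addAt, insertStep_cons_of_some (by rw [hm]), hm]
        simp [addAt, displace]
      | succ p =>
        obtain ⟨s, t, hr, -, -, -⟩ := exists_rowInsert_of_some hz
        rw [addAt, insertStep_cons_of_some hz, ih (h.1 z (by simp [hr])) h.2]
        rcases eq_or_ne (insertRow z T) p with hp | hp <;> simp [addAt, displace, hp]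

/-- The insertion tableau of a word, as the list of its rows. -/
def insertWord (w : List α) : List (List α) := w.foldl (fun T y => insertStep y T) []

@[simp] theorem insertWord_nil : insertWord ([] : List α) = [] := rfl

theorem insertWord_concat (w : List α) (y : α) :
    insertWord (w ++ [y]) = insertStep y (insertWord w) := by
  simp [insertWord]

theorem insertionTableau_eq_insertWord (x : ℕ → α) (n : ℕ) :
    insertionTableau x n = insertWord ((List.range n).map x) := by
  induction n with
  | zero => rfl
  | succ n ih =>
    rw [insertionTableau, ih, List.range_succ, List.map_append, List.map_singleton,
      insertWord_concat]

theorem flatten_insertWord_perm (w : List α) : (insertWord w).flatten.Perm w := by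
  induction w using List.reverseRecOn with
  | nil => rfl
  | append_singleton w y ih =>
    rw [insertWord_concat]
    exact (flatten_insertStep_perm y _).trans
      ((ih.cons y).trans (List.perm_append_singleton y w).symm)

theorem forall_mem_flatten_insertWord {p : α → Prop} {w : List α} (h : ∀ a ∈ w, p a) :
    ∀ a ∈ (insertWord w).flatten, p a :=
  fun a ha => h a ((flatten_insertWord_perm w).mem_iff.1 ha)

/-- The row lengths of the insertion tableau of a word. -/
def wordShape (w : List α) : ℕ → ℕ := rowLens (insertWord w)

theorem wordShape_concat (w : List α) (y : α) :
    wordShape (w ++ [y]) = bump (wordShape w) (insertRow y (insertWord w)) := by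
  rw [wordShape, insertWord_concat, rowLens_insertStep, wordShape]

theorem insertWord_concat_of_forall_lt {m : α} {u : List α} (hu : ∀ a ∈ u, a < m) :
    insertWord (u ++ [m]) = addAt m 0 (insertWord u) := by
  rw [insertWord_concat, insertStep_of_forall_lt (forall_mem_flatten_insertWord hu)]

theorem wordShape_concat_of_forall_lt {m : α} {u : List α} (hu : ∀ a ∈ u, a < m) :
    wordShape (u ++ [m]) = bump (wordShape u) 0 := by
  rw [wordShape, insertWord_concat_of_forall_lt hu, rowLens_addAt, wordShape]

theorem insertWord_insert_concat {m y : α} {u s : List α} (hus : ∀ a ∈ u ++ s, a < m) (hy : y < m)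
    {p : ℕ} (hp : insertWord (u ++ m :: s) = addAt m p (insertWord (u ++ s))) :
    insertWord (u ++ m :: (s ++ [y])) =
      addAt m (displace (insertRow y (insertWord (u ++ s))) p) (insertWord (u ++ (s ++ [y]))) := by
  rw [← List.cons_append, ← List.append_assoc, insertWord_concat, hp,
    insertStep_addAt hy (forall_mem_flatten_insertWord hus), ← insertWord_concat,
    List.append_assoc]

theorem exists_insertWord_eq_addAt {m : α} {u s : List α} (hus : ∀ a ∈ u ++ s, a < m) :
    ∃ p, insertWord (u ++ m :: s) = addAt m p (insertWord (u ++ s)) := by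
  induction s using List.reverseRecOn with
  | nil => exact ⟨0, by simpa using insertWord_concat_of_forall_lt (by simpa using hus)⟩
  | append_singleton s y ih =>
    have hus' : ∀ a ∈ u ++ s, a < m := fun a ha => hus a (by grind)
    obtain ⟨p, hp⟩ := ih hus'
    exact ⟨_, insertWord_insert_concat hus' (hus y (by simp)) hp⟩

theorem rowSquare_wordShape {m y : α} {u s : List α} (hus : ∀ a ∈ u ++ s, a < m) (hy : y < m) :
    RowSquare (wordShape (u ++ s)) (wordShape (u ++ (s ++ [y]))) (wordShape (u ++ m :: s))
      (wordShape (u ++ m :: (s ++ [y]))) := by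
  obtain ⟨p, hp⟩ := exists_insertWord_eq_addAt hus
  refine ⟨insertRow y (insertWord (u ++ s)), p, ?_, ?_, ?_⟩
  · rw [← List.append_assoc, wordShape_concat]
  · rw [wordShape, hp, rowLens_addAt, wordShape]
  · rw [wordShape, insertWord_insert_concat hus hy hp, rowLens_addAt, wordShape]

theorem exists_eq_append_cons_max {w : List α} (hw : w.Nodup) (hne : w ≠ []) :
    ∃ u m s, w = u ++ m :: s ∧ ∀ a ∈ u ++ s, a < m := by
  obtain ⟨m, hm, hmax⟩ := Finset.exists_max_image w.toFinset id
    (List.toFinset_nonempty_iff w |>.2 hne)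
  obtain ⟨u, s, rfl⟩ := List.append_of_mem (List.mem_toFinset.1 hm)
  rw [List.nodup_middle, List.nodup_cons] at hw
  refine ⟨u, m, s, rfl, fun a ha => lt_of_le_of_ne (hmax a (List.mem_toFinset.2 (by grind))) ?_⟩
  rintro rfl
  exact hw.1 ha

theorem antitone_wordShape {w : List α} (hw : w.Nodup) : Antitone (wordShape w) := by
  induction hn : w.length using Nat.strong_induction_on generalizing w with
  | _ n ih =>
    rcases eq_or_ne w [] with rfl | hne
    · exact fun i j _ => le_rfl
    obtain ⟨u, m, s, rfl, hus⟩ := exists_eq_append_cons_max hw hne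
    have hnd : (u ++ s).Nodup := (List.nodup_cons.1 (List.nodup_middle.1 hw)).2
    rcases List.eq_nil_or_concat' s with rfl | ⟨s, y, rfl⟩
    · rw [List.append_nil] at hus hnd
      rw [wordShape_concat_of_forall_lt hus]
      exact antitone_bump_zero (ih u.length (by simp [← hn]) hnd rfl)
    · refine (rowSquare_wordShape (fun a ha => hus a (by grind)) (hus y (by simp))).antitone
        (ih (u ++ s).length ?_ ?_ rfl) (ih _ ?_ hnd rfl) (ih (u ++ m :: s).length ?_ ?_ rfl)
      all_goals grind

end Insertion

/-! ### Removing the first letter -/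

section FirstLetter

variable {α : Type*} [LinearOrder α] {m x y : α} {u s w : List α}

theorem exists_wordShape_cons_of_forall_lt (hnd : w.Nodup) (hw : ∀ a ∈ w, a < m) :
    ∃ p, wordShape (m :: w) = bump (wordShape w) p ∧ wordShape w p = 0 := by
  induction w using List.reverseRecOn with
  | nil => exact ⟨0, wordShape_concat_of_forall_lt (u := []) hw, rfl⟩
  | append_singleton w y ih =>
    have hnd' := hnd.of_append_left
    obtain ⟨p, hp, hp0⟩ := ih hnd' fun a ha => hw a (by simp [ha])
    have hrow := rowSquare_wordShape (u := []) (s := w) (fun a ha => hw a (by grind))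
      (hw y (by simp))
    simp only [List.nil_append, hp, wordShape_concat] at hrow
    refine ⟨_, by rw [wordShape_concat, hrow.eq_bump_displace], ?_⟩
    have hsucc := antitone_wordShape hnd' (Nat.le_succ p)
    simp only [wordShape_concat, bump, displace, Nat.succ_eq_add_one] at *
    grind

/-- The rule of jeu de taquin for the shapes of `u` and `x :: u` before and after the insertion of
a last letter `y`. -/
def JdtInsertion (x : α) (u : List α) (y : α) : Prop :=
  JdtSquare (wordShape u) (wordShape (x :: u)) (wordShape (u ++ [y])) (wordShape (x :: (u ++ [y])))

theorem exists_wordShape_cons_of_jdtInsertion (h : ∀ u y, w = u ++ [y] → JdtInsertion x u y) :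
    ∃ c, wordShape (x :: w) = bump (wordShape w) c := by
  rcases List.eq_nil_or_concat' w with rfl | ⟨u, y, rfl⟩
  · exact ⟨0, wordShape_concat_of_forall_lt (u := []) (by simp)⟩
  · exact (h u y rfl).exists_bump

theorem jdtInsertion_of_forall_lt_first (hnd : u.Nodup) (hx : ∀ a ∈ u ++ [y], a < x) :
    JdtInsertion x u y := by
  have hxu : ∀ a ∈ u, a < x := fun a ha => hx a (by simp [ha])
  obtain ⟨p, hp, hp0⟩ := exists_wordShape_cons_of_forall_lt hnd hxu
  have hrow := rowSquare_wordShape (u := []) hxu (hx y (by simp))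
  simp only [List.nil_append, hp, wordShape_concat] at hrow
  rw [JdtInsertion, hrow.eq_bump_displace, hp, wordShape_concat]
  refine ⟨p, _, _, rfl, rfl, bump_bump_displace .., fun h => if_neg h.symm, fun h => .inr ⟨?_, ?_⟩⟩
  · rw [displace, if_pos h.symm, h]
  · have := antitone_wordShape hnd (Nat.le_succ p)
    simp only [Nat.succ_eq_add_one] at this
    omega

theorem jdtInsertion_of_forall_lt_last (hm : ∀ a ∈ x :: u, a < m)
    (hx : ∃ c, wordShape (x :: u) = bump (wordShape u) c) : JdtInsertion x u m := by
  obtain ⟨c, hc⟩ := hx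
  rw [JdtInsertion, ← List.cons_append, wordShape_concat_of_forall_lt hm,
    wordShape_concat_of_forall_lt (List.forall_mem_of_forall_mem_cons hm), hc]
  exact ⟨c, 0, 0, rfl, rfl, rfl, fun _ => rfl, Or.inl⟩

theorem colSquare_wordShape_of_jdtInsertion (hnd : (x :: (u ++ m :: s)).Nodup)
    (hm : ∀ a ∈ x :: (u ++ s), a < m) (hx : ∃ c, wordShape (x :: u) = bump (wordShape u) c)
    (hJ : ∀ t y, t ++ [y] <+: s → JdtInsertion x (u ++ t) y) :
    ColSquare (wordShape (u ++ s)) (wordShape (x :: (u ++ s))) (wordShape (u ++ m :: s))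
      (wordShape (x :: (u ++ m :: s))) := by
  induction s using List.reverseRecOn with
  | nil =>
    obtain ⟨c, hc⟩ := hx
    rw [List.append_nil] at hm ⊢
    rw [← List.cons_append, wordShape_concat_of_forall_lt hm,
      wordShape_concat_of_forall_lt (List.forall_mem_of_forall_mem_cons hm), hc]
    refine ⟨c, 0, 0, rfl, rfl, rfl, fun _ => rfl, ?_⟩
    rintro rfl
    simp [bump]
  | append_singleton s y ih =>
    have hJy := hJ s y List.prefix_rfl
    rw [JdtInsertion, List.append_assoc] at hJy
    refine ColSquare.opposite (antitone_wordShape ?_) (antitone_wordShape ?_)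
      (antitone_wordShape ?_) (antitone_wordShape ?_) hJy
      (ih ?_ (fun a ha => hm a (by grind)) fun t z ht => hJ t z (ht.trans (List.prefix_append ..)))
      (rowSquare_wordShape (fun a ha => hm a (by grind)) (hm y (by simp)))
      (rowSquare_wordShape (u := x :: u) (fun a ha => hm a (by grind)) (hm y (by simp)))
    all_goals grind

theorem jdtInsertion_of_jdtInsertion_of_colSquare (hnd : (x :: (u ++ m :: (s ++ [y]))).Nodup)
    (hm : ∀ a ∈ x :: (u ++ (s ++ [y])), a < m) (hJ : JdtInsertion x (u ++ s) y)
    (hC : ColSquare (wordShape (u ++ s)) (wordShape (x :: (u ++ s))) (wordShape (u ++ m :: s))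
      (wordShape (x :: (u ++ m :: s)))) : JdtInsertion x (u ++ m :: s) y := by
  rw [JdtInsertion, List.append_assoc] at hJ ⊢
  refine JdtSquare.opposite (antitone_wordShape ?_) (antitone_wordShape ?_)
    (antitone_wordShape ?_) (antitone_wordShape ?_) hJ hC
    (rowSquare_wordShape (fun a ha => hm a (by grind)) (hm y (by simp)))
    (rowSquare_wordShape (u := x :: u) (fun a ha => hm a (by grind)) (hm y (by simp)))
  all_goals grind

/-- By induction on the length of `u`: unless the largest letter is the first or the last one,
removing it leaves shorter words, and the cube closes. -/
theorem jdtInsertion (hnd : (x :: (u ++ [y])).Nodup) : JdtInsertion x u y := by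
  induction hn : u.length using Nat.strong_induction_on generalizing u y with
  | _ n ih =>
    have hcons : ∀ v : List α, v.length ≤ n → (x :: v).Nodup →
        ∃ c, wordShape (x :: v) = bump (wordShape v) c := fun v hv hndv =>
      exists_wordShape_cons_of_jdtInsertion fun t z ht =>
        ih t.length (by grind) (by grind) rfl
    obtain ⟨u', m, s, hsplit, hm⟩ := exists_eq_append_cons_max hnd (by simp)
    rcases u' with _ | ⟨x', u'⟩
    · obtain ⟨rfl, rfl⟩ := by simpa using hsplit
      exact jdtInsertion_of_forall_lt_first (by grind) hm
    obtain ⟨rfl, htail⟩ : x = x' ∧ u ++ [y] = u' ++ m :: s := by simpa using hsplit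
    rcases List.eq_nil_or_concat' s with rfl | ⟨s, z, rfl⟩
    · obtain ⟨rfl, rfl⟩ : u = u' ∧ y = m := by simpa using List.append_inj' htail rfl
      exact jdtInsertion_of_forall_lt_last (by simpa using hm) (hcons u hn.le (by grind))
    · obtain ⟨rfl, rfl⟩ : u = u' ++ m :: s ∧ y = z := by
        simpa using List.append_inj' (t₁ := [y]) (t₂ := [z]) (by simpa using htail) rfl
      simp only [List.append_assoc, List.cons_append] at hnd
      refine jdtInsertion_of_jdtInsertion_of_colSquare hnd hm
        (ih (u' ++ s).length (by grind) (by grind) rfl)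
        (colSquare_wordShape_of_jdtInsertion (by grind) (fun a ha => hm a (by grind))
          (hcons u' (by grind) (by grind)) ?_)
      rintro t z ⟨r, rfl⟩
      exact ih (u' ++ t).length (by grind) (by grind) rfl

end FirstLetter

/-! ### Infinite tableaux as paths in the Young graph -/

theorem ext_of_mem_iff {μ ν : YoungDiagram} (h : ∀ c, c ∈ μ ↔ c ∈ ν) : μ = ν :=
  YoungDiagram.ext (Finset.ext h)

theorem adds_of_mem_iff {μ ν : YoungDiagram} {m : ℕ × ℕ} (hm : m ∉ μ)
    (h : ∀ c, c ∈ ν ↔ c = m ∨ c ∈ μ) : Adds μ ν := by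
  have hcells : ν.cells = insert m μ.cells := by
    ext c
    simp [h]
  refine ⟨fun c hc => (h c).2 (Or.inr hc), ?_⟩
  rw [YoungDiagram.card, hcells, Finset.card_insert_of_notMem (by simpa using hm)]

/-- The paths in the Young graph that start at the empty diagram and eventually contain every
box. -/
structure IsExhaustingPath (p : ℕ → YoungDiagram) : Prop where
  zero : p 0 = ⊥
  adds : ∀ n, Adds (p n) (p (n + 1))
  exists_mem : ∀ c, ∃ n, c ∈ p n

/-- The step at which a box joins a path in the Young graph (`0` if it never does). -/
noncomputable def entryTime (p : ℕ → YoungDiagram) (c : ℕ × ℕ) : ℕ := sInf {n | c ∈ p n}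

namespace IsExhaustingPath

variable {p : ℕ → YoungDiagram} (hp : IsExhaustingPath p)

include hp

theorem entryTime_le_iff {c : ℕ × ℕ} {n : ℕ} : entryTime p c ≤ n ↔ c ∈ p n :=
  ⟨fun h => monotone_nat_of_le_succ (fun n => (hp.adds n).1) h (Nat.sInf_mem (hp.exists_mem c)),
    fun h => Nat.sInf_le h⟩

theorem entryTime_pos (c : ℕ × ℕ) : 0 < entryTime p c := by
  rw [← not_le, hp.entryTime_le_iff, hp.zero]
  exact YoungDiagram.notMem_bot c

theorem existsUnique_entryTime_eq (n : ℕ) : ∃! c, entryTime p c = n + 1 := by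
  obtain ⟨m, hm, hmem⟩ := exists_eq_insert (hp.adds n)
  refine ⟨m, ?_, fun c hc => ?_⟩
  · rw [← hp.entryTime_le_iff] at hm
    have := hp.entryTime_le_iff.2 ((hmem m).2 (Or.inl rfl))
    omega
  · refine ((hmem c).1 (hp.entryTime_le_iff.1 hc.le)).resolve_right fun h => ?_
    have := hp.entryTime_le_iff.2 h
    omega

theorem entryTime_injective : Function.Injective (entryTime p) := fun c d h => by
  obtain ⟨n, hn⟩ := Nat.exists_eq_succ_of_ne_zero (hp.entryTime_pos d).ne'
  exact (hp.existsUnique_entryTime_eq n).unique (h.trans hn) hn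

theorem entryTime_strictMono : StrictMono (entryTime p) := by
  refine Monotone.strictMono_of_injective (fun c d hcd => ?_) hp.entryTime_injective
  exact hp.entryTime_le_iff.2 ((p _).isLowerSet hcd (hp.entryTime_le_iff.1 le_rfl))

theorem bijOn_entryTime : Set.BijOn (entryTime p) Set.univ (Set.Ici 1) := by
  refine ⟨fun c _ => hp.entryTime_pos c, hp.entryTime_injective.injOn, fun n hn => ?_⟩
  obtain ⟨n, rfl⟩ := Nat.exists_eq_add_of_le' hn
  exact (hp.existsUnique_entryTime_eq n).exists.imp fun c hc => ⟨trivial, hc⟩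

theorem exists_infiniteTableau : ∃ t : InfiniteTableau, ∀ n c, t.entry c ≤ n ↔ c ∈ p n :=
  ⟨⟨entryTime p, hp.bijOn_entryTime,
    fun _ j => hp.entryTime_strictMono (Prod.mk_lt_mk.2 (.inr ⟨le_rfl, j.lt_succ_self⟩)),
    fun i _ => hp.entryTime_strictMono (Prod.mk_lt_mk.2 (.inl ⟨i.lt_succ_self, le_rfl⟩))⟩,
    fun _ _ => hp.entryTime_le_iff⟩

end IsExhaustingPath

namespace InfiniteTableau

theorem mem_shape (t : InfiniteTableau) {n : ℕ} {c : ℕ × ℕ} : c ∈ t.shape n ↔ t.entry c ≤ n := by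
  rw [← YoungDiagram.mem_cells]
  simp [shape]

theorem ext_of_le_iff {t t' : InfiniteTableau} (h : ∀ n c, t.entry c ≤ n ↔ t'.entry c ≤ n) :
    t = t' := by
  ext c
  exact le_antisymm ((h _ c).2 le_rfl) ((h _ c).1 le_rfl)

theorem shapePath_injective : Function.Injective shapePath := fun t t' h =>
  ext_of_le_iff fun n c => by
    rw [← mem_shape, ← mem_shape]
    exact iff_of_eq (congrArg (c ∈ ·) (congrFun h n))

theorem isExhaustingPath_shapePath (t : InfiniteTableau) : IsExhaustingPath t.shapePath where
  zero := ext_of_mem_iff fun c => by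
    simpa [shapePath, mem_shape] using Nat.one_le_iff_ne_zero.1 (t.one_le c)
  adds n := by
    obtain ⟨m, -, hm⟩ := t.bijOn.surjOn (Set.mem_Ici.2 (Nat.le_add_left 1 n))
    refine adds_of_mem_iff (m := m) ?_ fun c => ?_
    · simp [shapePath, mem_shape, hm]
    · simp only [shapePath, mem_shape, ← t.injective.eq_iff (a := c), hm]
      omega
  exists_mem _ := ⟨_, t.mem_shape.2 le_rfl⟩

theorem range_shapePath : Set.range shapePath = {p | IsExhaustingPath p} := by
  ext p
  refine ⟨?_, fun hp => ?_⟩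
  · rintro ⟨t, rfl⟩
    exact t.isExhaustingPath_shapePath
  · obtain ⟨t, ht⟩ := hp.exists_infiniteTableau
    exact ⟨t, funext fun n => ext_of_mem_iff fun c => t.mem_shape.trans (ht n c)⟩

end InfiniteTableau

/-! ### The shapes of a sequence and of its shift -/

section InitialWord

variable {α : Type*} {x : ℕ → α}

/-- The first `n` terms of a sequence. -/
def initialWord (x : ℕ → α) (n : ℕ) : List α := (List.range n).map x

theorem initialWord_succ (x : ℕ → α) (n : ℕ) :
    initialWord x (n + 1) = initialWord x n ++ [x n] := by
  simp [initialWord, List.range_succ]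

theorem initialWord_succ_eq_cons (x : ℕ → α) (n : ℕ) :
    initialWord x (n + 1) = x 0 :: initialWord (shift x) n := by
  simp [initialWord, List.range_succ_eq_map, shift, Function.comp_def]

theorem nodup_initialWord (hx : Function.Injective x) (n : ℕ) : (initialWord x n).Nodup :=
  List.nodup_range.map hx

theorem injective_of_nodup_initialWord (h : ∀ n, (initialWord x n).Nodup) :
    Function.Injective x := fun i j hij =>
  List.inj_on_of_nodup_map (h (max i j + 1)) (by simp) (by simp) hij

theorem shift_injective (hx : Function.Injective x) : Function.Injective (shift x) :=
  hx.comp Nat.succ_injective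

end InitialWord

section WordDiagram

variable {α : Type*}

theorem finite_rowLens (T : List (List α)) : {c : ℕ × ℕ | c.2 < rowLens T c.1}.Finite := by
  refine ((Set.finite_Iio T.length).biUnion (t := fun i => Prod.mk i '' Set.Iio (rowLens T i))
    fun i _ => (Set.finite_Iio _).image _).subset ?_
  rintro ⟨i, j⟩ hj
  refine Set.mem_biUnion (Set.mem_Iio.2 (not_le.1 fun hi => ?_)) ⟨j, hj, rfl⟩
  simp [rowLens, List.getElem?_eq_none hi] at hj

variable [LinearOrder α] {w : List α}

open Classical in
/-- The shape of the insertion tableau of a word without repetitions, as a Young diagram (and the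
empty diagram for a word with repetitions). -/
noncomputable def wordDiagram (w : List α) : YoungDiagram :=
  if h : w.Nodup then
    { cells := (finite_rowLens (insertWord w)).toFinset
      isLowerSet := by
        rintro ⟨i, j⟩ ⟨i', j'⟩ hle hc
        obtain ⟨hi, hj⟩ := Prod.mk_le_mk.1 hle
        simp only [Set.Finite.coe_toFinset, Set.mem_ofPred_eq] at hc ⊢
        exact hj.trans_lt (hc.trans_le (antitone_wordShape h hi)) }
  else ⊥

theorem mem_wordDiagram (hw : w.Nodup) {c : ℕ × ℕ} :
    c ∈ wordDiagram w ↔ c.2 < wordShape w c.1 := by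
  rw [wordDiagram, dif_pos hw, ← YoungDiagram.mem_cells]
  simp [wordShape]

theorem wordDiagram_nil : wordDiagram ([] : List α) = ⊥ :=
  ext_of_mem_iff fun c => by simp [mem_wordDiagram List.nodup_nil, wordShape]

theorem mem_wordDiagram_iff_of_eq_bump {w' : List α} {b : ℕ} (hw : w.Nodup) (hw' : w'.Nodup)
    (h : wordShape w' = bump (wordShape w) b) (c : ℕ × ℕ) :
    c ∈ wordDiagram w' ↔ c = (b, wordShape w b) ∨ c ∈ wordDiagram w := by
  rw [mem_wordDiagram hw, mem_wordDiagram hw', h, bump, Prod.ext_iff]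
  grind

theorem adds_wordDiagram_of_eq_bump {w' : List α} {b : ℕ} (hw : w.Nodup) (hw' : w'.Nodup)
    (h : wordShape w' = bump (wordShape w) b) : Adds (wordDiagram w) (wordDiagram w') :=
  adds_of_mem_iff (by simp [mem_wordDiagram hw]) (mem_wordDiagram_iff_of_eq_bump hw hw' h)

theorem adds_wordDiagram_concat {y : α} (hw : (w ++ [y]).Nodup) :
    Adds (wordDiagram w) (wordDiagram (w ++ [y])) :=
  adds_wordDiagram_of_eq_bump hw.of_append_left hw (wordShape_concat w y)

theorem wordShape_eq_of_wordDiagram_eq {w' : List α} (hw : w.Nodup) (hw' : w'.Nodup)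
    (h : wordDiagram w = wordDiagram w') : wordShape w = wordShape w' :=
  funext fun i => eq_of_forall_lt_iff fun j => by
    rw [← mem_wordDiagram hw (c := (i, j)), h, mem_wordDiagram hw']

theorem card_wordDiagram (hw : w.Nodup) : (wordDiagram w).card = w.length := by
  induction w using List.reverseRecOn with
  | nil => simp [wordDiagram_nil]
  | append_singleton w y ih =>
    rw [(adds_wordDiagram_concat hw).2, ih hw.of_append_left, List.length_append,
      List.length_singleton]

end WordDiagram

section RskPath

variable {α : Type*} [LinearOrder α] {x : ℕ → α}

theorem mem_rskShape {n : ℕ} {c : ℕ × ℕ} :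
    c ∈ rskShape x n ↔ c.2 < wordShape (initialWord x n) c.1 := by
  rw [rskShape, insertionTableau_eq_insertWord]
  rfl

/-- The path in the Young graph traced by the RSK shapes of a sequence. -/
noncomputable def rskPath (x : ℕ → α) (n : ℕ) : YoungDiagram := wordDiagram (initialWord x n)

theorem mem_rskPath (hx : Function.Injective x) {n : ℕ} {c : ℕ × ℕ} :
    c ∈ rskPath x n ↔ c ∈ rskShape x n := by
  rw [rskPath, mem_wordDiagram (nodup_initialWord hx n), mem_rskShape]

theorem rskPath_zero (x : ℕ → α) : rskPath x 0 = ⊥ := wordDiagram_nil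

theorem adds_rskPath (hx : Function.Injective x) (n : ℕ) :
    Adds (rskPath x n) (rskPath x (n + 1)) := by
  have hnd := nodup_initialWord hx (n + 1)
  rw [initialWord_succ] at hnd
  rw [rskPath, rskPath, initialWord_succ]
  exact adds_wordDiagram_concat hnd

theorem injective_of_adds_rskPath (h : ∀ n, Adds (rskPath x n) (rskPath x (n + 1))) :
    Function.Injective x := by
  refine injective_of_nodup_initialWord fun n => ?_
  rcases n with _ | n
  · exact List.nodup_nil
  by_contra hnd
  have hcard := (h n).2
  rw [rskPath, rskPath, wordDiagram, dif_neg hnd] at hcard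
  simp [YoungDiagram.card] at hcard

theorem isRecordingTableau_rsk (hx : x ∈ rskDomain) : IsRecordingTableau x (rsk x) := by
  rw [rsk, dif_pos hx]
  exact hx.2.choose_spec

theorem shapePath_rsk (hx : x ∈ rskDomain) : (rsk x).shapePath = rskPath x :=
  funext fun n => ext_of_mem_iff fun c => by
    rw [mem_rskPath hx.1, ← isRecordingTableau_rsk hx]
    exact (rsk x).mem_shape

theorem isExhaustingPath_rskPath_iff : IsExhaustingPath (rskPath x) ↔ x ∈ rskDomain := by
  refine ⟨fun h => ?_, fun h => shapePath_rsk h ▸ (rsk x).isExhaustingPath_shapePath⟩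
  have hx := injective_of_adds_rskPath h.adds
  obtain ⟨t, ht⟩ := h.exists_infiniteTableau
  exact ⟨hx, t, fun n c => (ht n c).trans (mem_rskPath hx)⟩

theorem jdtSquare_initialWord (hx : Function.Injective x) (n : ℕ) :
    JdtSquare (wordShape (initialWord (shift x) n)) (wordShape (initialWord x (n + 1)))
      (wordShape (initialWord (shift x) (n + 1))) (wordShape (initialWord x (n + 2))) := by
  have hnd := nodup_initialWord hx (n + 2)
  rw [initialWord_succ_eq_cons, initialWord_succ] at hnd
  have hJ := jdtInsertion hnd
  rwa [JdtInsertion, ← initialWord_succ, ← initialWord_succ_eq_cons,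
    ← initialWord_succ_eq_cons] at hJ

theorem rskShape_shift_subset (hx : Function.Injective x) (n : ℕ) :
    rskShape (shift x) n ⊆ rskShape x (n + 1) := by
  intro c hc
  obtain ⟨r, -, -, h, -⟩ := jdtSquare_initialWord hx n
  rw [mem_rskShape] at hc ⊢
  rw [h]
  exact hc.trans_le (Nat.le_add_right _ _)

end RskPath

/-! ### Jeu de taquin of the recording tableau -/

theorem lt_iff_lt_bump_and_ne (l : ℕ → ℕ) (c : ℕ) (d : ℕ × ℕ) :
    d.2 < l d.1 ↔ d.2 < bump l c d.1 ∧ d ≠ (c, l c) := by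
  rw [bump, ne_eq, Prod.ext_iff]
  grind

namespace InfiniteTableau

variable {t : InfiniteTableau} {l : ℕ → ℕ} {n k c : ℕ}

/-- The boxes of `t` with entry at most `n` form the shape with row lengths `l`. -/
def HasRowLens (t : InfiniteTableau) (n : ℕ) (l : ℕ → ℕ) : Prop :=
  ∀ d, t.entry d ≤ n ↔ d.2 < l d.1

theorem strictMono_entry_jdtPath (t : InfiniteTableau) :
    StrictMono fun j => t.entry (t.jdtPath j) := strictMono_nat_of_lt_succ t.entry_jdtPath_lt

theorem entry_jdtPath_le_iff (hrows : t.HasRowLens n (bump l c)) (hl : Antitone l)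
    (hk : t.jdtPath k = (c, l c)) (j : ℕ) : t.entry (t.jdtPath j) ≤ n ↔ j ≤ k := by
  have hle : t.entry (t.jdtPath k) ≤ n := by
    rw [hk, hrows]
    simp [bump]
  have hcol : ¬ t.entry (c + 1, l c) ≤ n := by
    rw [hrows]
    simpa [bump] using hl (Nat.le_succ c)
  have hrow : ¬ t.entry (c, l c + 1) ≤ n := by
    rw [hrows]
    simp [bump]
  have hlt : n < t.entry (t.jdtPath (k + 1)) := by
    rw [jdtPath, hk]
    split_ifs
    · exact not_le.1 hcol
    · exact not_le.1 hrow
  refine ⟨fun h => not_lt.1 fun hj => ?_,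
    fun h => (t.strictMono_entry_jdtPath.monotone h).trans hle⟩
  exact (hlt.trans_le (t.strictMono_entry_jdtPath.monotone hj)).not_ge h

theorem entry_jdt_le_iff (hrows : t.HasRowLens (n + 1) (bump l c)) (hl : Antitone l)
    (hk : t.jdtPath k = (c, l c)) (d : ℕ × ℕ) : t.jdt.entry d ≤ n ↔ d.2 < l d.1 := by
  change t.jdtEntry d ≤ n ↔ _
  rw [lt_iff_lt_bump_and_ne l c, ← hrows, ← hk]
  by_cases hd : ∃ j, t.jdtPath j = d
  · obtain ⟨j, rfl⟩ := hd
    rw [t.jdtEntry_path, Nat.sub_le_iff_le_add, entry_jdtPath_le_iff hrows hl hk,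
      entry_jdtPath_le_iff hrows hl hk, t.jdtPath_injective.ne_iff, Nat.succ_le_iff,
      lt_iff_le_and_ne]
  · push Not at hd
    rw [t.jdtEntry_off hd, Nat.sub_le_iff_le_add, and_iff_left (hd k).symm]

theorem jdtPath_succ_eq_of_jdt_slide {d : ℕ} (hrows : t.HasRowLens n (bump (bump l c) d))
    (hl : Antitone l) (hd : d = c ∨ d = c + 1 ∧ l (c + 1) = l c) (hk : t.jdtPath k = (c, l c)) :
    t.jdtPath (k + 1) = (d, bump l c d) := by
  have hcol := hrows (c + 1, l c)
  have hrow := hrows (c, l c + 1)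
  have hanti := hl (Nat.le_succ c)
  simp only [bump, Nat.succ_eq_add_one] at hcol hrow hanti ⊢
  rw [jdtPath, hk]
  rcases hd with rfl | ⟨rfl, hlc⟩
  · rw [if_neg (by grind)]
    simp
  · rw [if_pos (by grind)]
    simp [hlc]

end InfiniteTableau

section Recording

variable {α : Type*} [LinearOrder α] {x : ℕ → α}

theorem IsRecordingTableau.hasRowLens {t : InfiniteTableau} (ht : IsRecordingTableau x t) (n : ℕ) :
    t.HasRowLens n (wordShape (initialWord x n)) := fun d => (ht n d).trans mem_rskShape

theorem exists_jdtPath_eq (hx : Function.Injective x) {t : InfiniteTableau}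
    (ht : IsRecordingTableau x t) (n : ℕ) :
    ∃ k c, wordShape (initialWord x (n + 1)) = bump (wordShape (initialWord (shift x) n)) c ∧
      t.jdtPath k = (c, wordShape (initialWord (shift x) n) c) := by
  induction n with
  | zero => exact ⟨0, 0, wordShape_concat_of_forall_lt (u := []) (by simp), rfl⟩
  | succ n ih =>
    obtain ⟨k, c, hc, hk⟩ := ih
    obtain ⟨c', b, d, hc', hl', hA', hne, heq⟩ := jdtSquare_initialWord hx n
    obtain rfl := bump_injective _ (hc.symm.trans hc')
    rcases eq_or_ne b c with rfl | hbc
    · refine ⟨k + 1, d, by rw [hA', hc, hl'], ?_⟩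
      rw [hl']
      refine InfiniteTableau.jdtPath_succ_eq_of_jdt_slide (n := n + 2) ?_
        (antitone_wordShape (nodup_initialWord (shift_injective hx) n)) (heq rfl) hk
      rw [← hc, ← hA']
      exact ht.hasRowLens (n + 2)
    · obtain rfl := hne hbc
      refine ⟨k, c, by rw [hA', hc, hl', bump_comm], ?_⟩
      rw [hk, hl', bump, if_neg hbc.symm, add_zero]

theorem isRecordingTableau_shift (hx : Function.Injective x) {t : InfiniteTableau}
    (ht : IsRecordingTableau x t) : IsRecordingTableau (shift x) t.jdt := by
  intro n d
  obtain ⟨k, c, hc, hk⟩ := exists_jdtPath_eq hx ht n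
  have hrows := ht.hasRowLens (n + 1)
  rw [hc] at hrows
  rw [mem_rskShape]
  exact InfiniteTableau.entry_jdt_le_iff hrows
    (antitone_wordShape (nodup_initialWord (shift_injective hx) n)) hk d

theorem shift_mem_rskDomain (hx : x ∈ rskDomain) : shift x ∈ rskDomain :=
  ⟨shift_injective hx.1, _, isRecordingTableau_shift hx.1 (isRecordingTableau_rsk hx)⟩

theorem jdt_rsk (hx : x ∈ rskDomain) : (rsk x).jdt = rsk (shift x) :=
  InfiniteTableau.ext_of_le_iff fun n c => by
    rw [isRecordingTableau_shift hx.1 (isRecordingTableau_rsk hx),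
      isRecordingTableau_rsk (shift_mem_rskDomain hx)]

end Recording

/-! ### Counting permutations with a given sequence of shapes -/

section Recovery

variable {α : Type*} [LinearOrder α]

/-- The rows of a tableau, given as the list of its rows, are weakly increasing. -/
def SortedRows (T : List (List α)) : Prop := ∀ r ∈ T, r.Pairwise (· ≤ ·)

theorem sortedRows_cons {r : List α} {T : List (List α)} :
    SortedRows (r :: T) ↔ r.Pairwise (· ≤ ·) ∧ SortedRows T :=
  List.forall_mem_cons

theorem eq_or_mem_of_mem_rowInsert {y b : α} {r : List α} (h : b ∈ (rowInsert y r).1) :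
    b = y ∨ b ∈ r := by
  rcases hz : (rowInsert y r).2 with _ | z
  · rw [rowInsert_of_none hz] at h
    grind
  · obtain ⟨s, t, hr, hr', -, -⟩ := exists_rowInsert_of_some hz
    grind

theorem pairwise_rowInsert {r : List α} (hr : r.Pairwise (· ≤ ·)) (y : α) :
    (rowInsert y r).1.Pairwise (· ≤ ·) := by
  induction r with
  | nil => simp [rowInsert]
  | cons a r ih =>
    rw [List.pairwise_cons] at hr
    rw [rowInsert]
    split_ifs with hya
    · exact List.pairwise_cons.2 ⟨fun b hb => hya.le.trans (hr.1 b hb), hr.2⟩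
    · refine List.pairwise_cons.2 ⟨fun b hb => ?_, ih hr.2⟩
      rcases eq_or_mem_of_mem_rowInsert hb with rfl | hb
      · exact not_lt.1 hya
      · exact hr.1 b hb

theorem sortedRows_insertStep {T : List (List α)} (hT : SortedRows T) (y : α) :
    SortedRows (insertStep y T) := by
  induction T generalizing y with
  | nil => simp [insertStep, SortedRows]
  | cons r T ih =>
    rw [sortedRows_cons] at hT
    rw [insertStep]
    split
    · exact sortedRows_cons.2 ⟨pairwise_rowInsert hT.1 y, hT.2⟩
    · exact sortedRows_cons.2 ⟨pairwise_rowInsert hT.1 y, ih hT.2 _⟩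

theorem sortedRows_insertWord (w : List α) : SortedRows (insertWord w) := by
  induction w using List.reverseRecOn with
  | nil => simp [SortedRows]
  | append_singleton w y ih =>
    rw [insertWord_concat]
    exact sortedRows_insertStep ih y

theorem rowInsert_ne_nil (y : α) (r : List α) : (rowInsert y r).1 ≠ [] := by
  cases r with
  | nil => simp [rowInsert]
  | cons a r =>
    rw [rowInsert]
    split_ifs <;> simp

theorem nil_notMem_insertStep {T : List (List α)} (hT : [] ∉ T) (y : α) :
    [] ∉ insertStep y T := by
  induction T generalizing y with
  | nil => simp [insertStep]
  | cons r T ih =>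
    rw [List.mem_cons, not_or] at hT
    rw [insertStep]
    split <;> rw [List.mem_cons, not_or]
    · exact ⟨(rowInsert_ne_nil y r).symm, hT.2⟩
    · exact ⟨(rowInsert_ne_nil y r).symm, ih hT.2 _⟩

theorem nil_notMem_insertWord (w : List α) : [] ∉ insertWord w := by
  induction w using List.reverseRecOn with
  | nil => simp
  | append_singleton w y ih =>
    rw [insertWord_concat]
    exact nil_notMem_insertStep ih y

theorem eq_nil_of_rowLens_eq_zero {β : Type*} {T : List (List β)} (hT : [] ∉ T)
    (h : rowLens T 0 = 0) : T = [] := by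
  cases T with
  | nil => rfl
  | cons r T =>
    rw [rowLens_cons_zero, List.length_eq_zero_iff] at h
    simp [h] at hT

theorem exists_lt_of_rowInsert_some {y z : α} {r : List α} (h : (rowInsert y r).2 = some z) :
    ∃ b ∈ (rowInsert y r).1, b < z := by
  obtain ⟨s, t, -, hr', hyz, -⟩ := exists_rowInsert_of_some h
  exact ⟨y, by simp [hr'], hyz⟩

theorem eq_of_rowInsert_eq {y y' : α} {r r' : List α} (hr : r.Pairwise (· ≤ ·))
    (hr' : r'.Pairwise (· ≤ ·)) (hlen : r.length = r'.length)
    (h : rowInsert y r = rowInsert y' r') : y = y' ∧ r = r' := by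
  induction r generalizing r' with
  | nil =>
    obtain rfl : r' = [] := List.length_eq_zero_iff.1 hlen.symm
    simpa [rowInsert] using h
  | cons a r ih =>
    obtain ⟨a', r', rfl⟩ := List.exists_cons_of_length_eq_add_one hlen.symm
    rw [List.pairwise_cons] at hr hr'
    -- If only one insertion bumps the head, that head is a lower bound for the common tail, where
    -- the other insertion has put a letter smaller than the one it bumps.
    have not_mixed : ∀ {c x : α} {s : List α}, (∀ b ∈ (rowInsert x s).1, c ≤ b) →
        some c ≠ (rowInsert x s).2 := fun hc hsome =>
      have ⟨b, hb, hbc⟩ := exists_lt_of_rowInsert_some hsome.symm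
      (hc b hb).not_gt hbc
    rw [rowInsert, rowInsert] at h
    split_ifs at h <;> simp only [Prod.mk.injEq, List.cons.injEq, Option.some.injEq] at h
    · exact ⟨h.1.1, by rw [h.2, h.1.2]⟩
    · exact absurd h.2 (not_mixed (h.1.2 ▸ hr.1))
    · exact absurd h.2.symm (not_mixed (h.1.2 ▸ hr'.1))
    · obtain ⟨rfl, rfl⟩ := ih hr.2 hr'.2 (by simpa using hlen) (Prod.ext h.1.2 h.2)
      exact ⟨rfl, by rw [h.1.1]⟩

theorem eq_of_insertStep_eq {y y' : α} {T T' : List (List α)} (hT : SortedRows T)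
    (hT' : SortedRows T') (hnil : [] ∉ T) (hnil' : [] ∉ T') (hlens : rowLens T = rowLens T')
    (h : insertStep y T = insertStep y' T') : y = y' ∧ T = T' := by
  have hrow : insertRow y T = insertRow y' T' := bump_injective (rowLens T) <| by
    rw [← rowLens_insertStep, h, hlens, rowLens_insertStep]
  induction T generalizing T' y y' with
  | nil =>
    obtain rfl := eq_nil_of_rowLens_eq_zero hnil' (congrFun hlens 0).symm
    simpa [insertStep] using h
  | cons r T ih =>
    rcases T' with _ | ⟨r', T'⟩
    · exact absurd (eq_nil_of_rowLens_eq_zero hnil (congrFun hlens 0)) (List.cons_ne_nil r T)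
    have hlen : r.length = r'.length := congrFun hlens 0
    rw [sortedRows_cons] at hT hT'
    rw [List.mem_cons, not_or] at hnil hnil'
    rcases hz : (rowInsert y r).2 with _ | z <;> rcases hz' : (rowInsert y' r').2 with _ | z'
    · rw [insertStep_cons_of_none hz, insertStep_cons_of_none hz', List.cons.injEq] at h
      obtain ⟨rfl, hy⟩ := List.append_inj h.1 hlen
      exact ⟨List.singleton_inj.1 hy, by rw [h.2]⟩
    · simp [insertRow_cons_of_none hz, insertRow_cons_of_some hz'] at hrow
    · simp [insertRow_cons_of_none hz', insertRow_cons_of_some hz] at hrow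
    · rw [insertStep_cons_of_some hz, insertStep_cons_of_some hz', List.cons.injEq] at h
      rw [insertRow_cons_of_some hz, insertRow_cons_of_some hz', Nat.add_right_cancel_iff] at hrow
      obtain ⟨rfl, rfl⟩ := ih hT.2 hT'.2 hnil.2 hnil'.2 (funext fun i => congrFun hlens (i + 1))
        h.2 hrow
      obtain ⟨rfl, rfl⟩ := eq_of_rowInsert_eq hT.1 hT'.1 hlen
        (Prod.ext h.1 (hz.trans hz'.symm))
      exact ⟨rfl, rfl⟩

theorem length_eq_of_insertWord_eq {w w' : List α} (h : insertWord w = insertWord w') :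
    w.length = w'.length :=
  (flatten_insertWord_perm w).length_eq.symm.trans (h ▸ (flatten_insertWord_perm w').length_eq)

theorem eq_of_insertWord_eq {w w' : List α}
    (hshape : ∀ k < w.length, wordShape (w.take k) = wordShape (w'.take k))
    (h : insertWord w = insertWord w') : w = w' := by
  have hlen := length_eq_of_insertWord_eq h
  induction w using List.reverseRecOn generalizing w' with
  | nil => exact (List.length_eq_zero_iff.1 hlen.symm).symm
  | append_singleton w y ih =>
    rcases List.eq_nil_or_concat' w' with rfl | ⟨w', y', rfl⟩
    · simp at hlen
    have hlen' : w.length = w'.length := by simpa using hlen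
    have hprev : wordShape w = wordShape w' := by
      simpa [hlen'] using hshape w.length (by simp)
    rw [insertWord_concat, insertWord_concat] at h
    obtain ⟨rfl, hT⟩ := eq_of_insertStep_eq (sortedRows_insertWord w) (sortedRows_insertWord w')
      (nil_notMem_insertWord w) (nil_notMem_insertWord w') hprev h
    rw [ih (fun k hk => ?_) hT hlen']
    simpa [List.take_append_of_le_length hk.le, List.take_append_of_le_length (hlen' ▸ hk.le)]
      using hshape k (by grind)

end Recovery

section StandardTableau

/-- The entries of a tableau given as the list of its rows, with value `0` off the tableau. -/
def tableauEntry (T : List (List ℕ)) (c : ℕ × ℕ) : ℕ := (T.getD c.1 []).getD c.2 0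

theorem tableauEntry_addAt (m p : ℕ) (T : List (List ℕ)) (c : ℕ × ℕ) :
    tableauEntry (addAt m p T) c = if c = (p, rowLens T p) then m else tableauEntry T c := by
  obtain ⟨i, j⟩ := c
  induction p generalizing T i with
  | zero =>
    rcases T with _ | ⟨r, T⟩ <;> rcases i with _ | i
    · rcases j with _ | j <;> simp [tableauEntry, addAt]
    · simp [tableauEntry, addAt]
    · simp only [tableauEntry, addAt, List.getD_cons_zero, Prod.mk.injEq, true_and,
        rowLens_cons_zero]
      rcases lt_trichotomy j r.length with hj | rfl | hj
      · rw [if_neg hj.ne, List.getD_append _ _ _ _ hj]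
      · simp
      · rw [if_neg hj.ne', List.getD_eq_default _ _ (by simpa using hj),
          List.getD_eq_default _ _ hj.le]
    · simp [tableauEntry, addAt]
  | succ p ih =>
    rcases T with _ | ⟨r, T⟩ <;> rcases i with _ | i
    · simp [tableauEntry, addAt]
    · simpa [tableauEntry, addAt] using ih [] i
    · simp [tableauEntry, addAt]
    · simpa [tableauEntry, addAt] using ih T i

theorem eq_of_tableauEntry_eq {T T' : List (List ℕ)} (hnil : [] ∉ T) (hnil' : [] ∉ T')
    (hlens : rowLens T = rowLens T') (h : tableauEntry T = tableauEntry T') : T = T' := by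
  induction T generalizing T' with
  | nil => exact (eq_nil_of_rowLens_eq_zero hnil' (congrFun hlens 0).symm).symm
  | cons r T ih =>
    rcases T' with _ | ⟨r', T'⟩
    · exact eq_nil_of_rowLens_eq_zero hnil (congrFun hlens 0)
    rw [List.mem_cons, not_or] at hnil hnil'
    congr 1
    · refine List.ext_getElem (congrFun hlens 0) fun j hj hj' => ?_
      have hentry : r.getD j 0 = r'.getD j 0 := congrFun h (0, j)
      rwa [List.getD_eq_getElem _ _ hj, List.getD_eq_getElem _ _ hj'] at hentry
    · exact ih hnil.2 hnil'.2 (funext fun i => congrFun hlens (i + 1))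
        (funext fun c => congrFun h (c.1 + 1, c.2))

theorem isStandardTableau_insertWord_insert {m : ℕ} {u s : List ℕ}
    (hnd : (u ++ m :: s).Nodup) (hus : ∀ a ∈ u ++ s, a < m) (hm : (u ++ m :: s).length = m)
    (h : IsStandardTableau (wordDiagram (u ++ s)) (tableauEntry (insertWord (u ++ s)))) :
    IsStandardTableau (wordDiagram (u ++ m :: s)) (tableauEntry (insertWord (u ++ m :: s))) := by
  have hnd' : (u ++ s).Nodup := (List.nodup_cons.1 (List.nodup_middle.1 hnd)).2
  obtain ⟨p, hp⟩ := exists_insertWord_eq_addAt hus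
  have hbump : wordShape (u ++ m :: s) = bump (wordShape (u ++ s)) p := by
    rw [wordShape, hp, rowLens_addAt, wordShape]
  have hnew (c : ℕ × ℕ) : c ∈ wordDiagram (u ++ m :: s) ∧ c ∉ wordDiagram (u ++ s) ↔
      c = (p, wordShape (u ++ s) p) := by
    rw [mem_wordDiagram_iff_of_eq_bump hnd' hnd hbump, or_and_right,
      or_iff_left (fun h => h.2 h.1), and_iff_left_iff_imp]
    rintro rfl
    simp [mem_wordDiagram hnd']
  convert isStandardTableau_extend (adds_wordDiagram_of_eq_bump hnd' hnd hbump) h using 1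
  funext c
  rw [hp, tableauEntry_addAt, card_wordDiagram hnd, hm]
  simp only [hnew, wordShape]

theorem isStandardTableau_insertWord {n : ℕ} {w : List ℕ}
    (hw : w.Perm ((List.range n).map (· + 1))) :
    IsStandardTableau (wordDiagram w) (tableauEntry (insertWord w)) := by
  induction n generalizing w with
  | zero =>
    obtain rfl : w = [] := by simpa using hw
    rw [wordDiagram_nil]
    constructor <;> simp [tableauEntry, YoungDiagram.card, Set.BijOn, Set.MapsTo, Set.SurjOn,
      Set.InjOn]
  | succ n ih =>
    have hnd : w.Nodup := hw.nodup_iff.2 (List.nodup_range.map (add_left_injective 1))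
    obtain ⟨u, s, rfl⟩ := List.append_of_mem (hw.mem_iff.2 (by simp) : n + 1 ∈ w)
    have hus : (u ++ s).Perm ((List.range n).map (· + 1)) := by
      rw [List.range_succ, List.map_append, List.map_singleton] at hw
      exact ((List.perm_middle.symm.trans hw).trans (List.perm_append_singleton _ _)).cons_inv
    refine isStandardTableau_insertWord_insert hnd (fun a ha => ?_) (by simpa using hw.length_eq)
      (ih hus)
    have := hus.mem_iff.1 ha
    simp only [List.mem_map, List.mem_range] at this
    omega

end StandardTableau

section PermWord

variable {n : ℕ}

/-- A permutation of `Fin n` in one-line notation, as a word in the letters `1, …, n`. -/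
def permWord (σ : Equiv.Perm (Fin n)) : List ℕ := List.ofFn fun i => (σ i : ℕ) + 1

@[simp] theorem length_permWord (σ : Equiv.Perm (Fin n)) : (permWord σ).length = n := by
  simp [permWord]

theorem permWord_perm (σ : Equiv.Perm (Fin n)) :
    (permWord σ).Perm ((List.range n).map (· + 1)) := by
  have hone : permWord (1 : Equiv.Perm (Fin n)) = (List.range n).map (· + 1) :=
    List.ext_getElem (by simp) (by simp [permWord])
  exact hone ▸ Equiv.Perm.ofFn_comp_perm σ fun i : Fin n => (i : ℕ) + 1

theorem nodup_permWord (σ : Equiv.Perm (Fin n)) : (permWord σ).Nodup :=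
  (permWord_perm σ).nodup_iff.2 (List.nodup_range.map (add_left_injective 1))

theorem permWord_injective : Function.Injective (permWord (n := n)) := fun σ τ h =>
  Equiv.ext fun i => Fin.ext (by simpa using congrFun (List.ofFn_injective h) i)

/-- The permutations of `Fin n` whose initial segments have the RSK shapes prescribed by `p`. -/
def permsWithShapes (p : ℕ → YoungDiagram) (n : ℕ) : Set (Equiv.Perm (Fin n)) :=
  {σ | ∀ k ≤ n, wordDiagram ((permWord σ).take k) = p k}

theorem wordDiagram_permWord {p : ℕ → YoungDiagram} {σ : Equiv.Perm (Fin n)}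
    (hσ : σ ∈ permsWithShapes p n) : wordDiagram (permWord σ) = p n := by
  rw [← hσ n le_rfl, List.take_of_length_le (length_permWord σ).le]

/-- This is the inequality half of the Robinson–Schensted correspondence: a permutation is
determined by its insertion tableau together with the shapes of its initial segments. -/
theorem ncard_permsWithShapes_le (p : ℕ → YoungDiagram) (n : ℕ) :
    (permsWithShapes p n).ncard ≤ numSYT (p n) := by
  have := finite_standardTableau (p n)
  refine Nat.card_le_card_of_injective (fun σ : permsWithShapes p n =>
    ⟨tableauEntry (insertWord (permWord σ.1)),
      wordDiagram_permWord σ.2 ▸ isStandardTableau_insertWord (permWord_perm σ.1)⟩) ?_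
  rintro ⟨σ, hσ⟩ ⟨τ, hτ⟩ hστ
  have hshape : ∀ k ≤ n, wordShape ((permWord σ).take k) = wordShape ((permWord τ).take k) :=
    fun k hk => wordShape_eq_of_wordDiagram_eq (nodup_permWord σ).take (nodup_permWord τ).take
      ((hσ k hk).trans (hτ k hk).symm)
  have hlast : wordShape (permWord σ) = wordShape (permWord τ) := by
    simpa [List.take_of_length_le] using hshape n le_rfl
  have hinsert : insertWord (permWord σ) = insertWord (permWord τ) :=
    eq_of_tableauEntry_eq (nil_notMem_insertWord _) (nil_notMem_insertWord _) hlast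
      (congrArg Subtype.val hστ)
  exact Subtype.ext (permWord_injective (eq_of_insertWord_eq
    (fun k hk => hshape k (by simpa using hk.le)) hinsert))

end PermWord

/-! ### The law of the RSK shapes of an i.i.d. sequence -/

section StrictMonoMap

variable {α β : Type*} [LinearOrder α] [LinearOrder β] {φ : α → β}

theorem rowInsert_map (hφ : StrictMono φ) (y : α) (r : List α) :
    rowInsert (φ y) (r.map φ) = ((rowInsert y r).1.map φ, (rowInsert y r).2.map φ) := by
  induction r with
  | nil => rfl
  | cons a r ih =>
    simp only [List.map_cons, rowInsert, hφ.lt_iff_lt, ih]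
    split_ifs <;> rfl

theorem insertStep_map (hφ : StrictMono φ) (y : α) (T : List (List α)) :
    insertStep (φ y) (T.map (List.map φ)) = (insertStep y T).map (List.map φ) := by
  induction T generalizing y with
  | nil => rfl
  | cons r T ih =>
    rw [List.map_cons, insertStep, insertStep, rowInsert_map hφ]
    cases (rowInsert y r).2 <;> simp [ih]

theorem insertWord_map (hφ : StrictMono φ) (w : List α) :
    insertWord (w.map φ) = (insertWord w).map (List.map φ) := by
  induction w using List.reverseRecOn with
  | nil => rfl
  | append_singleton w y ih =>
    rw [List.map_append, List.map_singleton, insertWord_concat, ih, insertStep_map hφ,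
      insertWord_concat]

theorem wordShape_map (hφ : StrictMono φ) (w : List α) : wordShape (w.map φ) = wordShape w := by
  funext i
  rw [wordShape, insertWord_map hφ, wordShape, rowLens, rowLens, ← List.map_nil (f := φ),
    List.getD_map, List.length_map]

theorem wordDiagram_map (hφ : StrictMono φ) {w : List α} (hw : w.Nodup) :
    wordDiagram (w.map φ) = wordDiagram w :=
  ext_of_mem_iff fun c => by
    rw [mem_wordDiagram (hw.map hφ.injective), mem_wordDiagram hw, wordShape_map hφ]

end StrictMonoMap

section Pattern

theorem initialWord_eq_ofFn {α : Type*} (x : ℕ → α) (n : ℕ) :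
    initialWord x n = List.ofFn fun i : Fin n => x i :=
  List.ext_getElem (by simp [initialWord]) fun i h1 h2 => by simp [initialWord]

theorem take_initialWord {α : Type*} (x : ℕ → α) {k n : ℕ} (h : k ≤ n) :
    (initialWord x n).take k = initialWord x k := by
  rw [initialWord, ← List.map_take, List.take_range, min_eq_left h, initialWord]

variable {α : Type*} [LinearOrder α] {n : ℕ} {σ : Equiv.Perm (Fin n)} {x : ℕ → α}

/-- The sequences whose first `n` terms are in the same relative order as the values of `σ`: the
`k`-th smallest of them stands in position `σ⁻¹ k`. -/
def hasPattern (α : Type*) [LinearOrder α] (σ : Equiv.Perm (Fin n)) : Set (ℕ → α) :=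
  {x | StrictMono fun k : Fin n => x (σ.symm k)}

theorem exists_mem_hasPattern (hx : (initialWord x n).Nodup) :
    ∃ σ : Equiv.Perm (Fin n), x ∈ hasPattern α σ := by
  rw [initialWord_eq_ofFn, List.nodup_ofFn] at hx
  exact ⟨(Tuple.sort fun i : Fin n => x i).symm,
    (Tuple.monotone_sort fun i : Fin n => x i).strictMono_of_injective
      (hx.comp (Equiv.injective _))⟩

theorem nodup_of_mem_hasPattern (hx : x ∈ hasPattern α σ) : (initialWord x n).Nodup := by
  rw [initialWord_eq_ofFn, List.nodup_ofFn]
  exact (Equiv.injective_comp σ.symm fun i : Fin n => x i).1 (StrictMono.injective hx)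

theorem pairwise_disjoint_hasPattern (α : Type*) [LinearOrder α] (n : ℕ) :
    Pairwise (Function.onFun Disjoint (hasPattern (n := n) α)) := by
  intro σ τ hne
  refine Set.disjoint_left.2 fun x hσ hτ => hne ?_
  have hrange (ρ : Equiv.Perm (Fin n)) :
      Set.range (fun k => x (ρ.symm k)) = Set.range fun k : Fin n => x k :=
    ρ.symm.surjective.range_comp fun k : Fin n => x k
  have hsort := (StrictMono.range_inj hσ hτ).1 ((hrange σ).trans (hrange τ).symm)
  have hinj := nodup_of_mem_hasPattern hσ
  rw [initialWord_eq_ofFn, List.nodup_ofFn] at hinj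
  exact Equiv.symm_bijective.injective (Equiv.ext fun k => hinj (congrFun hsort k))

theorem rskPath_of_mem_hasPattern (hx : x ∈ hasPattern α σ) {k : ℕ} (hk : k ≤ n) :
    rskPath x k = wordDiagram ((permWord σ).take k) := by
  have hword : initialWord x n = (List.ofFn σ).map fun k => x (σ.symm k) := by
    rw [initialWord_eq_ofFn, List.map_ofFn]
    simp [Function.comp_def]
  have hperm : permWord σ = (List.ofFn σ).map fun i : Fin n => (i : ℕ) + 1 := by
    rw [permWord, List.map_ofFn, Function.comp_def]
  have hnd : ((List.ofFn σ).take k).Nodup := (List.nodup_ofFn.2 σ.injective).take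
  have hsucc : StrictMono fun i : Fin n => (i : ℕ) + 1 := fun i j h => Nat.succ_lt_succ h
  rw [rskPath, ← take_initialWord x hk, hword, hperm, ← List.map_take, ← List.map_take,
    wordDiagram_map hx hnd, wordDiagram_map hsucc hnd]

theorem mem_permsWithShapes_of_mem_hasPattern {p : ℕ → YoungDiagram} (hx : x ∈ hasPattern α σ)
    (hp : ∀ k ≤ n, rskPath x k = p k) : σ ∈ permsWithShapes p n :=
  fun k hk => rskPath_of_mem_hasPattern hx hk ▸ hp k hk

end Pattern

section Measurability

variable {α : Type*} [LinearOrder α] [TopologicalSpace α] [OrderClosedTopology α]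
  [SecondCountableTopology α] [MeasurableSpace α] [OpensMeasurableSpace α]

theorem measurableSet_strictMono (ι : Type*) [Preorder ι] [Countable ι] :
    MeasurableSet {f : ι → α | StrictMono f} := by
  have hinter : {f : ι → α | StrictMono f} = ⋂ (i) (j) (_ : i < j), {f | f i < f j} := by
    ext f
    simp only [Set.mem_iInter]
    rfl
  rw [hinter]
  exact .iInter fun i => .iInter fun j => .iInter fun _ =>
    measurableSet_lt (measurable_pi_apply i) (measurable_pi_apply j)

theorem measurableSet_hasPattern {n : ℕ} (σ : Equiv.Perm (Fin n)) :
    MeasurableSet (hasPattern α σ) :=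
  (measurableSet_strictMono (Fin n)).preimage
    (measurable_pi_iff.2 fun k => measurable_pi_apply (σ.symm k : ℕ))

open Classical in
theorem measurable_rskPath : Measurable (rskPath : (ℕ → α) → ℕ → YoungDiagram) := by
  refine measurable_pi_iff.2 fun n => ?_
  let patterns : (ℕ → α) → Set (Equiv.Perm (Fin n)) := fun x => {σ | x ∈ hasPattern α σ}
  let shape : Set (Equiv.Perm (Fin n)) → YoungDiagram :=
    fun S => if h : S.Nonempty then wordDiagram (permWord h.some) else ⊥
  have hpatterns : Measurable patterns :=
    measurable_set_iff.2 fun σ => measurable_mem.2 (measurableSet_hasPattern σ)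
  have hshape : (fun x : ℕ → α => rskPath x n) = shape ∘ patterns := by
    funext x
    by_cases h : (patterns x).Nonempty
    · simp [shape, h, rskPath_of_mem_hasPattern h.some_mem le_rfl, List.take_of_length_le]
    · simp [shape, h, rskPath, wordDiagram, mt exists_mem_hasPattern h]
  rw [hshape]
  exact Measurable.of_discrete.comp hpatterns

end Measurability

section Law

theorem measure_prod_diagonal {α : Type*} [MeasurableSpace α] [MeasurableEq α] {μ ν : Measure α}
    [SFinite ν] [NullSingletonClass ν] : (μ.prod ν) (Set.diagonal α) = 0 := by
  rw [Measure.measure_prod_null measurableSet_diagonal]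
  refine Filter.Eventually.of_forall fun a => ?_
  have hslice : Prod.mk a ⁻¹' Set.diagonal α = {a} := by
    ext b
    simp [eq_comm]
  simp [hslice]

variable {α : Type*} [MeasurableSpace α] {μ : Measure α} [IsProbabilityMeasure μ]

/-- The law of a sequence of independent random variables with law `μ`. -/
noncomputable def iidLaw (μ : Measure α) [IsProbabilityMeasure μ] : Measure (ℕ → α) :=
  Measure.infinitePi fun _ => μ

instance : IsProbabilityMeasure (iidLaw μ) :=
  inferInstanceAs (IsProbabilityMeasure (Measure.infinitePi _))

theorem iidLaw_map_comp {ι : Type*} {f : ι → ℕ} (hf : Function.Injective f) :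
    (iidLaw μ).map (fun x i => x (f i)) = Measure.infinitePi fun _ : ι => μ :=
  Measure.map_infinitePi_infinitePi_of_inj hf

theorem ae_injective_iidLaw [MeasurableEq α] [NullSingletonClass μ] :
    ∀ᵐ x ∂iidLaw μ, Function.Injective x := by
  have hne (i j : ℕ) : ∀ᵐ x ∂iidLaw μ, x i = x j → i = j := by
    rcases eq_or_ne i j with hij | hij
    · simp [hij]
    have hdiag : iidLaw μ ((fun x => (x i, x j)) ⁻¹' Set.diagonal α) = 0 := by
      rw [← Measure.map_apply (by fun_prop) measurableSet_diagonal, iidLaw,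
        Measure.infinitePi_map_eval_prod hij, measure_prod_diagonal]
    filter_upwards [measure_eq_zero_iff_ae_notMem.1 hdiag] with x hx hxij
    exact absurd hxij hx
  filter_upwards [ae_all_iff.2 fun i => ae_all_iff.2 (hne i)] with x hx i j using hx i j

variable [LinearOrder α] [TopologicalSpace α] [OrderClosedTopology α]
  [SecondCountableTopology α] [OpensMeasurableSpace α]

theorem iidLaw_hasPattern {n : ℕ} (σ : Equiv.Perm (Fin n)) :
    iidLaw μ (hasPattern α σ) =
      (Measure.infinitePi fun _ : Fin n => μ) {f | StrictMono f} := by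
  have hinj : Function.Injective fun k => (σ.symm k : ℕ) :=
    Fin.val_injective.comp σ.symm.injective
  rw [← iidLaw_map_comp hinj, Measure.map_apply
    (measurable_pi_iff.2 fun k => measurable_pi_apply (σ.symm k : ℕ)) (measurableSet_strictMono _)]
  rfl

theorem iidLaw_hasPattern_le {n : ℕ} (σ : Equiv.Perm (Fin n)) :
    iidLaw μ (hasPattern α σ) ≤ (n.factorial : ℝ≥0∞)⁻¹ := by
  have hequal (τ : Equiv.Perm (Fin n)) :
      iidLaw μ (hasPattern α τ) = iidLaw μ (hasPattern α σ) := by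
    rw [iidLaw_hasPattern, iidLaw_hasPattern]
  rw [ENNReal.le_inv_iff_mul_le, mul_comm]
  calc (n.factorial : ℝ≥0∞) * iidLaw μ (hasPattern α σ)
      = ∑ τ : Equiv.Perm (Fin n), iidLaw μ (hasPattern α τ) := by
        simp [hequal, Fintype.card_perm]
    _ = iidLaw μ (⋃ τ : Equiv.Perm (Fin n), hasPattern α τ) := by
        rw [measure_iUnion (pairwise_disjoint_hasPattern α n) measurableSet_hasPattern,
          tsum_fintype]
    _ ≤ 1 := prob_le_one

variable [NullSingletonClass μ]

theorem iidLaw_rskPath_le (n : ℕ) (p : ℕ → YoungDiagram) :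
    iidLaw μ {x | ∀ k ≤ n, rskPath x k = p k} ≤ numSYT (p n) * (n.factorial : ℝ≥0∞)⁻¹ := by
  set S := (permsWithShapes p n).toFinite.toFinset
  have hsub : {x : ℕ → α | ∀ k ≤ n, rskPath x k = p k} ≤ᵐ[iidLaw μ] ⋃ σ ∈ S, hasPattern α σ := by
    filter_upwards [ae_injective_iidLaw] with x hx hp
    obtain ⟨σ, hσ⟩ := exists_mem_hasPattern (nodup_initialWord hx n)
    exact Set.mem_iUnion₂.2
      ⟨σ, (Set.Finite.mem_toFinset _).2 (mem_permsWithShapes_of_mem_hasPattern hσ hp), hσ⟩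
  calc iidLaw μ {x | ∀ k ≤ n, rskPath x k = p k}
      ≤ iidLaw μ (⋃ σ ∈ S, hasPattern α σ) := measure_mono_ae hsub
    _ ≤ ∑ σ ∈ S, iidLaw μ (hasPattern α σ) := measure_biUnion_finset_le _ _
    _ ≤ ∑ _ ∈ S, (n.factorial : ℝ≥0∞)⁻¹ := Finset.sum_le_sum fun σ _ => iidLaw_hasPattern_le σ
    _ = (permsWithShapes p n).ncard * (n.factorial : ℝ≥0∞)⁻¹ := by
        rw [Finset.sum_const, nsmul_eq_mul, Set.ncard_eq_toFinset_card _]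
    _ ≤ numSYT (p n) * (n.factorial : ℝ≥0∞)⁻¹ := by
        gcongr
        exact ncard_permsWithShapes_le p n

end Law

/-! ### The Plancherel growth process as the law of the RSK shapes -/

section PlancherelGrowth

instance : IsProbabilityMeasure plancherelGrowth :=
  inferInstanceAs (IsProbabilityMeasure (Kernel.trajMeasure (X := fun _ => YoungDiagram) _ _))

theorem preimage_frestrictLe_singleton {β : Type*} (n : ℕ) (p : ℕ → β) :
    Preorder.frestrictLe (π := fun _ : ℕ => β) n ⁻¹' {Preorder.frestrictLe n p} =
      {h | ∀ k ≤ n, h k = p k} := by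
  ext h
  simp only [Set.mem_preimage, Set.mem_singleton_iff, Set.mem_ofPred_eq, funext_iff, Subtype.forall,
    Finset.mem_Iic]
  rfl

theorem measurableSet_forall_le_eq {β : Type*} [MeasurableSpace β] [MeasurableSingletonClass β]
    (n : ℕ) (p : ℕ → β) : MeasurableSet {h : ℕ → β | ∀ k ≤ n, h k = p k} := by
  rw [← preimage_frestrictLe_singleton]
  exact (measurableSet_singleton _).preimage (by fun_prop)

theorem setOf_forall_le_succ_eq {β : Type*} (n : ℕ) (p : ℕ → β) :
    {h : ℕ → β | ∀ k ≤ n + 1, h k = p k} =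
      (fun h : ℕ → β => (Preorder.frestrictLe (π := fun _ : ℕ => β) n h, h (n + 1))) ⁻¹'
        ({Preorder.frestrictLe n p} ×ˢ {p (n + 1)}) := by
  rw [Set.mk_preimage_prod, preimage_frestrictLe_singleton]
  ext h
  simp only [Nat.le_succ_iff_eq_or_le, or_imp, forall_and, forall_eq]
  exact and_comm

theorem plancherelGrowth_zero : plancherelGrowth {h | h 0 = ⊥} = 1 := by
  have hlaw : plancherelGrowth.map (Preorder.frestrictLe 0) =
      (Measure.dirac (⊥ : YoungDiagram)).map
        (MeasurableEquiv.piUnique (fun _ : Finset.Iic 0 => YoungDiagram)).symm := by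
    rw [plancherelGrowth, Kernel.trajMeasure, Measure.map_comp _ _ (by fun_prop),
      Kernel.traj_map_frestrictLe, Kernel.partialTraj_self, Measure.id_comp]
  have hset : {h : ℕ → YoungDiagram | h 0 = ⊥} = Preorder.frestrictLe
      (π := fun _ : ℕ => YoungDiagram) 0 ⁻¹' {f | f ⟨0, by simp⟩ = ⊥} := rfl
  have hmeas : MeasurableSet {f : (i : Finset.Iic 0) → YoungDiagram | f ⟨0, by simp⟩ = ⊥} :=
    measurable_pi_apply _ (measurableSet_singleton _)
  rw [hset, ← Measure.map_apply (by fun_prop) hmeas, hlaw, Measure.map_apply (by fun_prop) hmeas,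
    Measure.dirac_apply' _ (hmeas.preimage (by fun_prop))]
  exact Set.indicator_of_mem (show _ = _ from rfl) _

theorem plancherelGrowth_succ (n : ℕ) (p : ℕ → YoungDiagram) :
    plancherelGrowth {h | ∀ k ≤ n + 1, h k = p k} =
      plancherelGrowth {h | ∀ k ≤ n, h k = p k} * transitionProb (p n) (p (n + 1)) := by
  have hmeas : MeasurableSet ({Preorder.frestrictLe n p} :
      Set ((i : Finset.Iic n) → (fun _ : ℕ => YoungDiagram) i)) := measurableSet_singleton _
  rw [setOf_forall_le_succ_eq,
    ← Measure.map_apply (by fun_prop) (hmeas.prod (measurableSet_singleton _)), plancherelGrowth,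
    ← Kernel.map_frestrictLe_trajMeasure_compProd_eq_map_trajMeasure,
    Measure.compProd_apply_prod hmeas (measurableSet_singleton _), lintegral_singleton,
    Measure.map_apply (by fun_prop) hmeas, preimage_frestrictLe_singleton, mul_comm]
  congr 1
  exact PMF.toMeasure_apply_singleton _ _ (measurableSet_singleton _)

theorem card_eq_of_forall_adds {n : ℕ} {p : ℕ → YoungDiagram} (h0 : p 0 = ⊥)
    (hp : ∀ k < n, Adds (p k) (p (k + 1))) : (p n).card = n := by
  induction n with
  | zero => simp [h0, YoungDiagram.card]
  | succ n ih => rw [(hp n n.lt_succ_self).2, ih fun k hk => hp k (hk.trans n.lt_succ_self)]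

theorem plancherelGrowth_path {n : ℕ} {p : ℕ → YoungDiagram} (h0 : p 0 = ⊥)
    (hp : ∀ k < n, Adds (p k) (p (k + 1))) :
    plancherelGrowth {h | ∀ k ≤ n, h k = p k} = numSYT (p n) * (n.factorial : ℝ≥0∞)⁻¹ := by
  induction n with
  | zero => simp [h0, plancherelGrowth_zero, numSYT_bot]
  | succ n ih =>
    have hp' : ∀ k < n, Adds (p k) (p (k + 1)) := fun k hk => hp k (hk.trans n.lt_succ_self)
    have hf : (numSYT (p n) : ℝ≥0∞) ≠ 0 := by exact_mod_cast (numSYT_pos (p n)).ne'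
    have hf' : (numSYT (p n) : ℝ≥0∞) ≠ ∞ := ENNReal.natCast_ne_top _
    rw [plancherelGrowth_succ, ih hp', transitionProb, if_pos (hp n n.lt_succ_self),
      card_eq_of_forall_adds h0 hp', Nat.factorial_succ, Nat.cast_mul, div_eq_mul_inv,
      ENNReal.mul_inv (Or.inr hf') (Or.inr hf),
      ENNReal.mul_inv (Or.inr (ENNReal.natCast_ne_top _)) (Or.inl (ENNReal.natCast_ne_top _))]
    calc numSYT (p n) * (n.factorial : ℝ≥0∞)⁻¹ *
          (numSYT (p (n + 1)) * (((n + 1 : ℕ) : ℝ≥0∞)⁻¹ * (numSYT (p n) : ℝ≥0∞)⁻¹))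
        = numSYT (p n) * (numSYT (p n) : ℝ≥0∞)⁻¹ *
          (numSYT (p (n + 1)) * (((n + 1 : ℕ) : ℝ≥0∞)⁻¹ * (n.factorial : ℝ≥0∞)⁻¹)) := by ring
      _ = numSYT (p (n + 1)) * (((n + 1 : ℕ) : ℝ≥0∞)⁻¹ * (n.factorial : ℝ≥0∞)⁻¹) := by
        rw [ENNReal.mul_inv_cancel hf hf', one_mul]

end PlancherelGrowth

section MapRskPath

theorem eq_of_forall_measure_singleton_le {β : Type*} [MeasurableSpace β] [Countable β]
    [MeasurableSingletonClass β] {μ ν : Measure β} [IsProbabilityMeasure μ]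
    [IsProbabilityMeasure ν] (h : ∀ a, μ {a} ≤ ν {a}) : μ = ν := by
  refine Measure.eq_of_le_of_isProbabilityMeasure (Measure.le_iff.2 fun s hs => ?_)
  rw [← Measure.tsum_indicator_apply_singleton μ s hs,
    ← Measure.tsum_indicator_apply_singleton ν s hs]
  exact ENNReal.tsum_le_tsum fun a => Set.indicator_le_indicator (h a)

variable {α : Type*} [LinearOrder α] [TopologicalSpace α] [OrderClosedTopology α]
  [SecondCountableTopology α] [MeasurableSpace α] [OpensMeasurableSpace α]
  {μ : Measure α} [IsProbabilityMeasure μ] [NullSingletonClass μ]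

theorem iidLaw_rskPath_le_plancherelGrowth (n : ℕ) (p : ℕ → YoungDiagram) :
    iidLaw μ {x | ∀ k ≤ n, rskPath x k = p k} ≤ plancherelGrowth {h | ∀ k ≤ n, h k = p k} := by
  by_cases hp : p 0 = ⊥ ∧ ∀ k < n, Adds (p k) (p (k + 1))
  · rw [plancherelGrowth_path hp.1 hp.2]
    exact iidLaw_rskPath_le n p
  · refine (measure_mono_null_ae (t := ∅) ?_ measure_empty).trans_le zero_le
    filter_upwards [ae_injective_iidLaw] with x hx hpx
    refine hp ⟨?_, fun k hk => ?_⟩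
    · rw [← hpx 0 (Nat.zero_le _), rskPath_zero]
    · rw [← hpx k hk.le, ← hpx (k + 1) hk]
      exact adds_rskPath hx k

/-- Both sides have total mass one, so the inequality between point masses is enough. -/
theorem map_frestrictLe_rskPath (n : ℕ) :
    ((iidLaw μ).map rskPath).map (Preorder.frestrictLe n) =
      plancherelGrowth.map (Preorder.frestrictLe (π := fun _ : ℕ => YoungDiagram) n) := by
  have := Measure.isProbabilityMeasure_map (μ := iidLaw μ) measurable_rskPath.aemeasurable
  have := Measure.isProbabilityMeasure_map (μ := (iidLaw μ).map rskPath)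
    (f := Preorder.frestrictLe (π := fun _ : ℕ => YoungDiagram) n) (by fun_prop)
  have := Measure.isProbabilityMeasure_map (μ := plancherelGrowth)
    (f := Preorder.frestrictLe (π := fun _ : ℕ => YoungDiagram) n) (by fun_prop)
  refine eq_of_forall_measure_singleton_le fun a => ?_
  obtain ⟨p, rfl⟩ : ∃ p : ℕ → YoungDiagram, Preorder.frestrictLe n p = a :=
    ⟨fun k => if h : k ≤ n then a ⟨k, Finset.mem_Iic.2 h⟩ else ⊥, funext fun k => by
      simp [Preorder.frestrictLe, Finset.mem_Iic.1 k.2]⟩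
  rw [Measure.map_apply (by fun_prop) (measurableSet_singleton _),
    Measure.map_apply (by fun_prop) (measurableSet_singleton _), preimage_frestrictLe_singleton,
    Measure.map_apply measurable_rskPath (measurableSet_forall_le_eq n p)]
  exact iidLaw_rskPath_le_plancherelGrowth n p

theorem map_rskPath : (iidLaw μ).map rskPath = plancherelGrowth := by
  have := Measure.isProbabilityMeasure_map (μ := iidLaw μ) measurable_rskPath.aemeasurable
  have hproj : IsProjectiveMeasureFamily (α := fun _ : ℕ => YoungDiagram)
      fun I : Finset ℕ => plancherelGrowth.map I.restrict := by
    intro I J hJI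
    rw [Measure.map_map (by fun_prop) (by fun_prop)]
    rfl
  exact IsProjectiveLimit.unique (P := fun I : Finset ℕ => plancherelGrowth.map I.restrict)
    ((isProjectiveLimit_nat_iff hproj _).2 map_frestrictLe_rskPath) fun I => rfl

end MapRskPath

/-! ### Ergodicity of the shift -/

section Shift

variable {α : Type*} [MeasurableSpace α] {μ : Measure α} [IsProbabilityMeasure μ]

theorem shift_iterate {α : Type*} (n : ℕ) (x : ℕ → α) : shift^[n] x = fun k => x (k + n) := by
  induction n generalizing x with
  | zero => rfl
  | succ n ih =>
    rw [Function.iterate_succ_apply, ih]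
    funext k
    rw [shift, add_assoc]

theorem measurePreserving_shift : MeasurePreserving shift (iidLaw μ) (iidLaw μ) :=
  ⟨measurable_pi_iff.2 fun n => measurable_pi_apply (n + 1), iidLaw_map_comp Nat.succ_injective⟩

theorem measurableSet_limsup_comap_eval {s : Set (ℕ → α)} (hs : MeasurableSet s)
    (hinv : shift ⁻¹' s = s) :
    MeasurableSet[Filter.limsup
      (fun n => MeasurableSpace.comap (fun x : ℕ → α => x n) inferInstance) Filter.atTop] s := by
  rw [Filter.limsup_eq_iInf_iSup_of_nat, MeasurableSpace.measurableSet_iInf]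
  intro n
  have hpre : shift^[n] ⁻¹' s = s := by
    rw [Set.preimage_iterate_eq]
    exact (Function.IsFixedPt.iterate hinv n :)
  rw [← hpre]
  refine @MeasurableSet.preimage _ _ (_) _ _ _ hs ?_
  refine @measurable_pi_lambda _ _ _ (_) _ _ fun k => ?_
  simp only [shift_iterate]
  exact (comap_measurable fun x : ℕ → α => x (k + n)).mono
    (le_iSup₂_of_le (k + n) (Nat.le_add_left n k) le_rfl) le_rfl

theorem ergodic_shift : Ergodic shift (iidLaw μ) := by
  refine ⟨measurePreserving_shift, ⟨fun s hs hinv => ?_⟩⟩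
  have hind : iIndep (fun n => MeasurableSpace.comap (fun x : ℕ → α => x n) inferInstance)
      (iidLaw μ) :=
    iIndepFun_infinitePi (P := fun _ : ℕ => μ) (X := fun _ => id) fun _ => measurable_id
  rw [Filter.eventuallyConst_set]
  rcases measure_zero_or_one_of_measurableSet_limsup_atTop
    (fun n => (measurable_pi_apply n).comap_le) hind
    (measurableSet_limsup_comap_eval hs hinv) with h | h
  · exact Or.inr (measure_eq_zero_iff_ae_notMem.1 h)
  · exact Or.inl ((prob_compl_eq_zero_iff hs).2 h)

end Shift

/-! ### Measurability of infinite tableaux and jeu de taquin -/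

namespace InfiniteTableau

theorem measurable_entry (c : ℕ × ℕ) : Measurable fun t : InfiniteTableau => t.entry c :=
  Measurable.of_comap_le (le_iSup (fun c : ℕ × ℕ =>
    MeasurableSpace.comap (fun t : InfiniteTableau => t.entry c) ⊤) c)

theorem measurable_of_measurableSet_entry_le {β : Type*} [MeasurableSpace β]
    {f : β → InfiniteTableau} (h : ∀ c n, MeasurableSet {b | (f b).entry c ≤ n}) :
    Measurable f := by
  refine measurable_iff_comap_le.2 (MeasurableSpace.comap_iSup.le.trans (iSup_le fun c => ?_))
  rw [MeasurableSpace.comap_comp]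
  exact (measurable_of_Iic (h c) : Measurable fun b => (f b).entry c).comap_le

theorem measurableSet_setOf_mem (n : ℕ) (c : ℕ × ℕ) :
    MeasurableSet {p : ℕ → YoungDiagram | c ∈ p n} :=
  (MeasurableSet.of_discrete (s := {μ : YoungDiagram | c ∈ μ})).preimage (measurable_pi_apply n)

theorem measurableSet_range_shapePath : MeasurableSet (Set.range shapePath) := by
  have hinter : Set.range shapePath = {p : ℕ → YoungDiagram | p 0 = ⊥} ∩
      ((⋂ n, {p | Adds (p n) (p (n + 1))}) ∩ ⋂ c, ⋃ n, {p | c ∈ p n}) := by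
    rw [range_shapePath]
    ext p
    simp only [Set.mem_inter_iff, Set.mem_ofPred_eq, Set.mem_iInter, Set.mem_iUnion]
    exact ⟨fun h => ⟨h.zero, h.adds, h.exists_mem⟩, fun h => ⟨h.1, h.2.1, h.2.2⟩⟩
  have hadds (n : ℕ) : MeasurableSet {p : ℕ → YoungDiagram | Adds (p n) (p (n + 1))} :=
    ((measurable_pi_apply n).prodMk (measurable_pi_apply (n + 1)) :
      Measurable fun p : ℕ → YoungDiagram => (p n, p (n + 1)))
      (MeasurableSet.of_discrete (s := {q : YoungDiagram × YoungDiagram | Adds q.1 q.2}))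
  rw [hinter]
  exact (measurableSet_eq_fun (measurable_pi_apply 0) measurable_const).inter
    ((MeasurableSet.iInter hadds).inter
      (.iInter fun c => .iUnion fun n => measurableSet_setOf_mem n c))

/-- The infinite tableau with a given path of shapes, and an arbitrary fixed tableau if there is
none: a left inverse of `shapePath`. -/
noncomputable def ofPath : (ℕ → YoungDiagram) → InfiniteTableau := Function.invFun shapePath

theorem ofPath_shapePath (t : InfiniteTableau) : ofPath t.shapePath = t :=
  Function.leftInverse_invFun shapePath_injective t

theorem measurable_ofPath : Measurable ofPath := by
  refine measurable_of_measurableSet_entry_le fun c n => ?_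
  have hsplit : {p : ℕ → YoungDiagram | (ofPath p).entry c ≤ n} =
      (Set.range shapePath).ite {p | c ∈ p n}
        {_p | (Classical.arbitrary InfiniteTableau).entry c ≤ n} := by
    ext p
    by_cases hp : p ∈ Set.range shapePath
    · obtain ⟨t, rfl⟩ := hp
      simp [Set.ite, ofPath_shapePath, shapePath, mem_shape]
    · have hofPath : ofPath p = Classical.arbitrary _ := Function.invFun_neg hp
      simp [Set.ite, hofPath, hp]
  rw [hsplit]
  exact measurableSet_range_shapePath.ite (measurableSet_setOf_mem n c) (.const _)

theorem measurable_shapePath : Measurable shapePath := by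
  refine measurable_pi_iff.2 fun n => measurable_to_countable' fun μ => ?_
  have hinter : (fun t : InfiniteTableau => t.shapePath n) ⁻¹' {μ} =
      ⋂ c : ℕ × ℕ, {t | t.entry c ≤ n ↔ c ∈ μ} := by
    ext t
    simp only [Set.mem_preimage, Set.mem_singleton_iff, Set.mem_iInter, Set.mem_ofPred_eq,
      ← mem_shape]
    exact ⟨fun h c => h ▸ Iff.rfl, ext_of_mem_iff⟩
  rw [hinter]
  exact .iInter fun c => measurable_entry c
    (MeasurableSet.of_discrete (s := {k : ℕ | k ≤ n ↔ c ∈ μ}))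

theorem measurableEmbedding_shapePath : MeasurableEmbedding shapePath :=
  .of_measurable_inverse measurable_shapePath measurableSet_range_shapePath measurable_ofPath
    ofPath_shapePath

theorem measurable_jdtPath (k : ℕ) : Measurable fun t : InfiniteTableau => t.jdtPath k := by
  induction k with
  | zero => exact measurable_const
  | succ k ih =>
    refine measurable_to_countable' fun c => ?_
    have hunion : (fun t : InfiniteTableau => t.jdtPath (k + 1)) ⁻¹' {c} =
        ⋃ d : ℕ × ℕ, (fun t : InfiniteTableau => t.jdtPath k) ⁻¹' {d} ∩
          {t | (if t.entry (d.1 + 1, d.2) < t.entry (d.1, d.2 + 1) then (d.1 + 1, d.2)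
            else (d.1, d.2 + 1)) = c} := by
      ext t
      simp [jdtPath]
    rw [hunion]
    refine .iUnion fun d => (ih (measurableSet_singleton d)).inter ?_
    exact measurableSet_eq_fun (Measurable.ite
      (measurableSet_lt (measurable_entry _) (measurable_entry _)) measurable_const
      measurable_const) measurable_const

/-- The `k`-th box of the jeu de taquin path lies on the `k`-th antidiagonal, so only that box has
to be compared with `c`. -/
theorem jdtEntry_eq_ite (t : InfiniteTableau) (c : ℕ × ℕ) :
    t.jdtEntry c = if t.jdtPath (c.1 + c.2) = c then
      min (t.entry (c.1 + 1, c.2)) (t.entry (c.1, c.2 + 1)) - 1 else t.entry c - 1 := by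
  split_ifs with hc
  · conv_lhs => rw [← hc, t.jdtEntry_path, jdtPath, hc]
    split_ifs with hlt
    · rw [min_eq_left hlt.le]
    · rw [min_eq_right (not_lt.1 hlt)]
  · refine t.jdtEntry_off fun k hk => hc ?_
    rw [← hk, t.jdtPath_sum]

theorem measurable_jdt : Measurable jdt := by
  refine measurable_of_measurableSet_entry_le fun c n => ?_
  have hentry : Measurable fun t : InfiniteTableau => t.jdtEntry c := by
    simp only [jdtEntry_eq_ite]
    exact Measurable.ite (measurable_jdtPath _ (measurableSet_singleton c))
      (((measurable_entry _).min (measurable_entry _)).sub_const 1)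
      ((measurable_entry c).sub_const 1)
  exact hentry measurableSet_Iic

end InfiniteTableau

/-! ### The factor map -/

section Factor

variable {α β : Type*} [MeasurableSpace α] [MeasurableSpace β] {μ : Measure α} {ν : Measure β}
  {f : α → α} {f' : β → β} {g : α → β}

theorem measurePreserving_of_ae_semiconj (hg : MeasurePreserving g μ ν)
    (hf : MeasurePreserving f μ μ) (hf' : Measurable f') (h : ∀ᵐ x ∂μ, f' (g x) = g (f x)) :
    MeasurePreserving f' ν ν := by
  refine ⟨hf', ?_⟩
  calc ν.map f' = μ.map (f' ∘ g) := by rw [← hg.map_eq, Measure.map_map hf' hg.measurable]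
    _ = μ.map (g ∘ f) := Measure.map_congr h
    _ = ν := (hg.comp hf).map_eq

theorem ergodic_of_ae_semiconj (hg : MeasurePreserving g μ ν) (hf : Ergodic f μ)
    (hf' : Measurable f') (h : ∀ᵐ x ∂μ, f' (g x) = g (f x)) : Ergodic f' ν := by
  refine ⟨measurePreserving_of_ae_semiconj hg hf.toMeasurePreserving hf' h, ⟨fun s hs hinv => ?_⟩⟩
  have hinv' : f ⁻¹' (g ⁻¹' s) =ᵐ[μ] g ⁻¹' s := by
    refine Filter.eventuallyEq_set.2 (h.mono fun x hx => ?_)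
    conv_rhs => rw [← hinv]
    simp only [Set.mem_preimage, hx]
  rw [← hg.aeconst_preimage hs.nullMeasurableSet]
  exact hf.quasiErgodic.aeconst_set₀ (hs.preimage hg.measurable).nullMeasurableSet hinv'

end Factor

theorem plancherelGrowth_setOf_exists_mem_ne_zero (c : ℕ × ℕ) :
    plancherelGrowth {p | ∃ n, c ∈ p n} ≠ 0 := by
  let t : InfiniteTableau := default
  have hpath := t.isExhaustingPath_shapePath
  have hsub : {p : ℕ → YoungDiagram | ∀ k ≤ t.entry c, p k = t.shapePath k} ⊆
      {p | ∃ n, c ∈ p n} :=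
    fun p hp => ⟨t.entry c, hp _ le_rfl ▸ t.mem_shape.2 le_rfl⟩
  have hpos : plancherelGrowth {p | ∀ k ≤ t.entry c, p k = t.shapePath k} ≠ 0 := by
    rw [plancherelGrowth_path hpath.zero fun k _ => hpath.adds k]
    exact mul_ne_zero (Nat.cast_ne_zero.2 (numSYT_pos _).ne')
      (ENNReal.inv_ne_zero.2 (ENNReal.natCast_ne_top _))
  exact fun hzero => hpos (measure_mono_null hsub hzero)

open Classical in
theorem rsk_eq_ite {α : Type*} [LinearOrder α] (x : ℕ → α) :
    rsk x = if x ∈ rskDomain then InfiniteTableau.ofPath (rskPath x) else default := by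
  split_ifs with hx
  · rw [← shapePath_rsk hx, InfiniteTableau.ofPath_shapePath]
  · exact dif_neg hx

section Rsk

variable {α : Type*} [LinearOrder α] [TopologicalSpace α] [OrderClosedTopology α]
  [SecondCountableTopology α] [MeasurableSpace α] [OpensMeasurableSpace α]
  {μ : Measure α} [IsProbabilityMeasure μ] [NullSingletonClass μ]

theorem ae_exists_mem_rskPath (c : ℕ × ℕ) : ∀ᵐ x ∂iidLaw μ, ∃ n, c ∈ rskPath x n := by
  have hmeas : MeasurableSet {p : ℕ → YoungDiagram | ∃ n, c ∈ p n} := by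
    simp only [Set.ofPred_exists]
    exact .iUnion fun n => InfiniteTableau.measurableSet_setOf_mem n c
  have hsub : shift ⁻¹' (rskPath ⁻¹' {p | ∃ n, c ∈ p n}) ≤ᵐ[iidLaw μ]
      (rskPath ⁻¹' {p | ∃ n, c ∈ p n} : Set (ℕ → α)) := by
    filter_upwards [ae_injective_iidLaw] with x hx
    rintro ⟨n, hn⟩
    exact ⟨n + 1, (mem_rskPath hx).2
      (rskShape_shift_subset hx n ((mem_rskPath (shift_injective hx)).1 hn))⟩
  rcases ergodic_shift.ae_empty_or_univ_of_preimage_ae_le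
    (hmeas.preimage measurable_rskPath).nullMeasurableSet hsub with hempty | huniv
  · refine absurd ?_ (plancherelGrowth_setOf_exists_mem_ne_zero c)
    rw [← map_rskPath (μ := μ), Measure.map_apply measurable_rskPath hmeas, measure_congr hempty,
      measure_empty]
  · exact Filter.eventuallyEq_univ.1 huniv

theorem ae_mem_rskDomain : ∀ᵐ x ∂iidLaw μ, x ∈ rskDomain := by
  filter_upwards [ae_injective_iidLaw, ae_all_iff.2 ae_exists_mem_rskPath] with x hx hmem
  exact isExhaustingPath_rskPath_iff.1 ⟨rskPath_zero x, adds_rskPath hx, hmem⟩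

theorem measurableSet_rskDomain : MeasurableSet (rskDomain : Set (ℕ → α)) := by
  have hpreimage : (rskDomain : Set (ℕ → α)) = rskPath ⁻¹' Set.range InfiniteTableau.shapePath := by
    ext x
    rw [InfiniteTableau.range_shapePath]
    exact isExhaustingPath_rskPath_iff.symm
  rw [hpreimage]
  exact InfiniteTableau.measurableSet_range_shapePath.preimage measurable_rskPath

theorem measurable_rsk : Measurable (rsk : (ℕ → α) → InfiniteTableau) := by
  classical
  rw [funext rsk_eq_ite]
  exact Measurable.ite measurableSet_rskDomain
    (InfiniteTableau.measurable_ofPath.comp measurable_rskPath) measurable_const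

theorem measurePreserving_rsk : MeasurePreserving rsk (iidLaw μ) plancherelMeasure := by
  have hemb := InfiniteTableau.measurableEmbedding_shapePath
  refine ⟨measurable_rsk, ?_⟩
  calc (iidLaw μ).map rsk
      = (((iidLaw μ).map rsk).map InfiniteTableau.shapePath).comap InfiniteTableau.shapePath :=
        (hemb.comap_map _).symm
    _ = ((iidLaw μ).map rskPath).comap InfiniteTableau.shapePath := by
        rw [Measure.map_map hemb.measurable measurable_rsk]
        congr 1
        refine Measure.map_congr ?_
        filter_upwards [ae_mem_rskDomain] with x hx using shapePath_rsk hx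
    _ = plancherelMeasure := by rw [map_rskPath, plancherelMeasure]

end Rsk

instance : IsProbabilityMeasure plancherelMeasure := by
  rw [← (measurePreserving_rsk (μ := (volume : Measure unitInterval))).map_eq]
  exact Measure.isProbabilityMeasure_map measurable_rsk.aemeasurable

theorem ergodic_jdt : Ergodic InfiniteTableau.jdt plancherelMeasure :=
  ergodic_of_ae_semiconj (measurePreserving_rsk (μ := (volume : Measure unitInterval)))
    ergodic_shift InfiniteTableau.measurable_jdt (ae_mem_rskDomain.mono fun _ => jdt_rsk)

end JeuDeTaquin

theorem mainTheorem4_general {α : Type*} [LinearOrder α] [TopologicalSpace α]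
    [OrderClosedTopology α] [SecondCountableTopology α] [MeasurableSpace α]
    [OpensMeasurableSpace α] (μ : Measure α) [IsProbabilityMeasure μ] [NullSingletonClass μ] :
    IsProbabilityMeasure JeuDeTaquin.plancherelMeasure ∧
    MeasurePreserving JeuDeTaquin.InfiniteTableau.jdt
      JeuDeTaquin.plancherelMeasure JeuDeTaquin.plancherelMeasure ∧
    Ergodic JeuDeTaquin.InfiniteTableau.jdt JeuDeTaquin.plancherelMeasure ∧
    (∀ᵐ x ∂JeuDeTaquin.iidLaw μ, x ∈ JeuDeTaquin.rskDomain) ∧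
    MeasurePreserving JeuDeTaquin.rsk (JeuDeTaquin.iidLaw μ) JeuDeTaquin.plancherelMeasure ∧
    (∀ x : ℕ → α, x ∈ JeuDeTaquin.rskDomain →
      JeuDeTaquin.shift x ∈ JeuDeTaquin.rskDomain ∧
      (JeuDeTaquin.rsk x).jdt = JeuDeTaquin.rsk (JeuDeTaquin.shift x)) :=
  ⟨inferInstance, JeuDeTaquin.ergodic_jdt.toMeasurePreserving, JeuDeTaquin.ergodic_jdt,
    JeuDeTaquin.ae_mem_rskDomain, JeuDeTaquin.measurePreserving_rsk,
    fun _ hx => ⟨JeuDeTaquin.shift_mem_rskDomain hx, JeuDeTaquin.jdt_rsk hx⟩⟩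

theorem mainTheorem4 :
    -- `P` is a probability measure, and `J` preserves it and is ergodic
    IsProbabilityMeasure JeuDeTaquin.plancherelMeasure ∧
    MeasurePreserving JeuDeTaquin.InfiniteTableau.jdt
      JeuDeTaquin.plancherelMeasure JeuDeTaquin.plancherelMeasure ∧
    Ergodic JeuDeTaquin.InfiniteTableau.jdt JeuDeTaquin.plancherelMeasure ∧
    -- the system is a factor, via RSK, of the shift on i.i.d. uniform sequences
    (∀ᵐ x ∂JeuDeTaquin.lebProduct, x ∈ JeuDeTaquin.rskDomain) ∧
    MeasurePreserving JeuDeTaquin.rsk JeuDeTaquin.lebProduct JeuDeTaquin.plancherelMeasure ∧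
    (∀ x : ℕ → unitInterval, x ∈ JeuDeTaquin.rskDomain →
      JeuDeTaquin.shift x ∈ JeuDeTaquin.rskDomain ∧
      (JeuDeTaquin.rsk x).jdt = JeuDeTaquin.rsk (JeuDeTaquin.shift x)) := by
  exact mainTheorem4_general (volume : Measure unitInterval)
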